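/- **Setting.** Let $T>0$, $\Omega=C([0,T],\mathbb{R})$ with the $\sigma$-algebra generated by the canonical process $X_t(\omega)=\omega(t)$. Let $\mathcal{H}$ be the Hilbert space of absolutely continuous $h:[0,T]\to\mathbb{R}$ with $h(0)=0$ and $\dot h\in L^2([0,T],dt)$, with $\langle h,g\rangle=\int_0^T\dot h(s)\dot g(s)\,ds$, and let $\chi_t(s)=\min(s,t)$, so that $\langle\chi_t,h\rangle=h(t)$. Let $k$ be a kernel with $k(t,\cdot)\in L^2([0,t])$ for all $t\in[0,T]$ such that $(Kh)(t)=\int_0^t k(t,s)\dot h(s)\,ds$ defines a bounded operator $K$ on $\mathcal{H}$; put $\Gamma=KK^*$. Let $\mathbb{P}$ be the law on $\Omega$ of a centered Gaussian process with covariance function $\gamma(s,t)=\int_0^{\min(s,t)}k(s,r)k(t,r)\,dr=\langle\chi_s,\Gamma\chi_t\rangle$. For $z\in\Omega$ let $\mathbb{P}_z$ be the law of $z+X$ under $\mathbb{P}$, with expectation $\mathbb{E}_z$. Let $\Gamma_\tau$ be a bounded self-adjoint nonnegative operator on $\mathcal{H}$ and $v\in\mathcal{H}$, and let $\mathbb{P}^\tau_v$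 be the law on $\Omega$ of a Gaussian process with mean function $v$ and covariance function $\langle\chi_s,\Gamma_\tau\chi_t\rangle$ (assumed to exist as a measure on $\Omega$). Assume that $\Gamma_\tau+\Gamma$ is injective and that $\Gamma_\tau\chi_t$ is in its range for all $t\in[0,T]$ (both hold if $\Gamma_\tau+\Gamma$ is invertible, e.g. $\Gamma_\tau=\tau^2 I$, $\tau\neq0$); $(\Gamma_\tau+\Gamma)^{-1}$ denotes the inverse, defined on that range. Let $\mu$ be a finite Borel measure on $[0,T]$. Let $\mathbb{M}=\int_\Omega\mathbb{P}_z\,d\mathbb{P}^\tau_v(z)$ be the law of the observation, and for $h\in\mathcal{H}$ let $X(h)\in L^2(\Omega,\mathbb{M})$ be the image of $h$ under the continuous linear map $\mathcal{H}\to L^2(\Omega,\mathbb{M})$ with $X(\chi_t)=X_t$. A drift estimator is a jointly measurable process $\xi=(\xi_t)_{t\in[0,T]}$ on $\Omega$; no adaptedness or unbiasedness is required. Its Bayes risk is $$B(\xi)=\int_\Omega\mathbb{E}_z\Big[\int_0^T|\xi_t-z_t|^2\,\mu(dt)\Big]d\mathbb{P}^\tau_v(z)\in[0,\infty].$$ **Proposition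 5.2 (Bayes estimator).** There is a drift estimator $\xi^{\tau,v}$ such that for every $t\in[0,T]$, $\mathbb{M}$-almost surely, $$\xi^{\tau,v}_t=\langle(\Gamma_\tau+\Gamma)^{-1}\Gamma\chi_t,\,v\rangle+X\big((\Gamma_\tau+\Gamma)^{-1}\Gamma_\tau\chi_t\big).$$ If $\Gamma$ and $\Gamma_\tau$ commute and $\Gamma v$ is in the range of $\Gamma_\tau+\Gamma$, the first term equals $\langle\chi_t,(\Gamma_\tau+\Gamma)^{-1}\Gamma v\rangle$ for every $t$. The function $t\mapsto\langle\chi_t,\Gamma(\Gamma_\tau+\Gamma)^{-1}\Gamma_\tau\chi_t\rangle$ is nonnegative and $\mu$-integrable. For every such $\xi^{\tau,v}$: 1. $B(\xi^{\tau,v})=\displaystyle\int_0^T\langle\chi_t,\Gamma(\Gamma_\tau+\Gamma)^{-1}\Gamma_\tau\chi_t\rangle\,\mu(dt)=\inf_\xi B(\xi)$, the infimum being over all drift estimators, and every drift estimator $\xi$ with $B(\xi)\le B(\xi^{\tau,v})$ satisfies $\xi=\xi^{\tau,v}$ $\mathbb{M}\otimes\mu$-a.e. 2. $\xi^{\tau,v}$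 is admissible in the following sense: if a drift estimator $\xi$ satisfies $$\mathbb{E}_z\Big[\int_0^T|\xi_t-z_t|^2\mu(dt)\Big]\le\mathbb{E}_z\Big[\int_0^T|\xi^{\tau,v}_t-z_t|^2\mu(dt)\Big]\quad\text{for all } z\in\Omega,$$ then $\xi=\xi^{\tau,v}$ $\mathbb{M}\otimes\mu$-a.e. -/

import Mathlib

open MeasureTheory ProbabilityTheory Filter Topology
open scoped ENNReal

noncomputable section

namespace GaussianDrift

/-- The time interval `[0, T]`. -/
abbrev TimeInterval (T : ℝ) : Type := Set.Icc (0 : ℝ) T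

/-- Lebesgue measure `dt` on `[0, T]`. -/
def leb (T : ℝ) : Measure (TimeInterval T) := Measure.comap Subtype.val volume

instance instIsFiniteMeasureLeb (T : ℝ) : IsFiniteMeasure (leb T) := by
  constructor
  rw [leb, comap_subtype_coe_apply measurableSet_Icc]
  exact (measure_mono (Subtype.coe_image_subset _ _)).trans_lt measure_Icc_lt_top

/-- The path space `Ω`: continuous real functions on `[0, T]`. -/
abbrev PathSpace (T : ℝ) : Type := C(TimeInterval T, ℝ)

/-- The σ-algebra on `Ω` generated by the canonical process `X_t(ω) = ω t`. -/
instance pathMeasurableSpace (T : ℝ) : MeasurableSpace (PathSpace T) :=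
  MeasurableSpace.comap (fun (ω : PathSpace T) (t : TimeInterval T) => ω t) MeasurableSpace.pi

/-- The Hilbert space of functions `h` on `[0, T]` that are absolutely continuous with `h 0 = 0` and
square-integrable derivative, under `⟨h, g⟩ = ∫₀ᵀ h' g' dt`.  A function `h` is represented by its
derivative `h' ∈ L²([0, T], dt)`; the function itself is recovered by `toFun`. -/
abbrev DriftSpace (T : ℝ) : Type := Lp ℝ 2 (leb T)

/-- The function `h(t) = ∫₀ᵗ h'(s) ds` represented by an element of `DriftSpace T`. -/
def toFun {T : ℝ} (h : DriftSpace T) (t : TimeInterval T) : ℝ := ∫ s in Set.Iic t, h s ∂(leb T)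

/-- The element `χ_t(s) = min s t`, whose derivative is the indicator of `[0, t]`. -/
def chi {T : ℝ} (t : TimeInterval T) : DriftSpace T :=
  indicatorConstLp 2 (measurableSet_Iic (a := t)) (measure_ne_top (leb T) (Set.Iic t)) (1 : ℝ)

/-- `⟨χ_t, h⟩ = h(t)`. -/
theorem inner_chi {T : ℝ} (t : TimeInterval T) (h : DriftSpace T) :
    inner ℝ (chi t) h = toFun h t := by
  rw [chi, L2.inner_indicatorConstLp_one, toFun]

/-- `K` is the operator `(K h)(t) = ∫₀ᵗ k(t, s) h'(s) ds` of a Volterra kernel `k` with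
`k(t, ·) ∈ L²(0, t)`.  By the closed graph theorem an operator of this form that is
defined on the whole of `DriftSpace T` is automatically bounded. -/
structure IsVolterraOperator {T : ℝ} (k : TimeInterval T → TimeInterval T → ℝ)
    (K : DriftSpace T →L[ℝ] DriftSpace T) : Prop where
  memLp : ∀ t, MemLp (k t) 2 ((leb T).restrict (Set.Iic t))
  apply_eq : ∀ h t, toFun (K h) t = ∫ s in Set.Iic t, k t s * h s ∂(leb T)

/-- The covariance function `γ(s, t) = ∫₀^{min s t} k(s, r) k(t, r) dr`. -/
def kernelCov {T : ℝ} (k : TimeInterval T → TimeInterval T → ℝ) (s t : TimeInterval T) : ℝ :=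
  ∫ r in Set.Iic (min s t), k s r * k t r ∂(leb T)

/-- Under the probability measure `Q` on `Ω`, the canonical process is Gaussian with mean
function `m` and covariance function `c`. -/
structure IsGaussianPathLaw {T : ℝ} (Q : Measure (PathSpace T)) (m : TimeInterval T → ℝ)
    (c : TimeInterval T → TimeInterval T → ℝ) : Prop where
  isProbability : IsProbabilityMeasure Q
  gaussian : IsGaussianProcess (fun (t : TimeInterval T) (ω : PathSpace T) => ω t) Q
  mean : ∀ t, ∫ ω, ω t ∂Q = m t
  cov : ∀ s t, covariance (fun ω : PathSpace T => ω s) (fun ω : PathSpace T => ω t) Q = c s t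

/-- The law `P_z`: the translation of `P` by the drift `z`. -/
def shiftedLaw {T : ℝ} (P : Measure (PathSpace T)) (z : PathSpace T) : Measure (PathSpace T) :=
  P.map (fun x => z + x)

/-- The marginal law of the observed process when the drift `z` has law `Q` and, given `z`, the
observation has law `P_z`. -/
def observationLaw {T : ℝ} (P Q : Measure (PathSpace T)) : Measure (PathSpace T) :=
  (Q.prod P).map (fun p => p.1 + p.2)

/-- A drift estimator: any jointly measurable process on `Ω`, indexed by `[0, T]`. -/
def IsDriftEstimator {T : ℝ} (ξ : TimeInterval T → PathSpace T → ℝ) : Prop :=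
  Measurable (Function.uncurry ξ)

/-- The risk `E_z[∫₀ᵀ |ξ_t - z_t|² μ(dt)] ∈ [0, ∞]`. -/
def risk {T : ℝ} (P : Measure (PathSpace T)) (μ : Measure (TimeInterval T))
    (ξ : TimeInterval T → PathSpace T → ℝ) (z : PathSpace T) : ℝ≥0∞ :=
  ∫⁻ ω, ∫⁻ t, ENNReal.ofReal ((ξ t ω - z t) ^ 2) ∂μ ∂(shiftedLaw P z)

/-- The Bayes risk `∫ E_z[∫₀ᵀ |ξ_t - z_t|² μ(dt)] dQ(z) ∈ [0, ∞]` under the prior `Q`. -/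
def bayesRisk {T : ℝ} (P Q : Measure (PathSpace T)) (μ : Measure (TimeInterval T))
    (ξ : TimeInterval T → PathSpace T → ℝ) : ℝ≥0∞ :=
  ∫⁻ z, risk P μ ξ z ∂Q

/-- `Y` is a version, under the law `M`, of the random variable `X(h)`, where `h ↦ X(h)` is the
linear map with `X(χ_t) = X_t`, extended from finite linear combinations of the `χ_t` by `L²`
limits. -/
def IsWienerIntegral {T : ℝ} (M : Measure (PathSpace T)) (h : DriftSpace T)
    (Y : PathSpace T → ℝ) : Prop :=
  MemLp Y 2 M ∧ ∃ c : ℕ → (TimeInterval T →₀ ℝ),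
    Tendsto (fun n => (c n).sum fun t a => a • chi t) atTop (𝓝 h) ∧
    Tendsto (fun n => eLpNorm (fun ω => ((c n).sum fun t a => a * ω t) - Y ω) 2 M) atTop (𝓝 0)

/-- The inverse `S⁻¹` of an injective operator `S`, to be used on the range of `S`. -/
def opInv {T : ℝ} (S : DriftSpace T →L[ℝ] DriftSpace T) : DriftSpace T → DriftSpace T :=
  Function.invFun S

/-- `ξ` is a version of the estimator
`ξ_t = ⟨(Γτ + Γ)⁻¹ Γ χ_t, v⟩ + X((Γτ + Γ)⁻¹ Γτ χ_t)`, where `M` is the law of `X`. -/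
def IsBayesEstimator {T : ℝ} (M : Measure (PathSpace T))
    (Γ Γτ : DriftSpace T →L[ℝ] DriftSpace T) (v : DriftSpace T)
    (ξ : TimeInterval T → PathSpace T → ℝ) : Prop :=
  IsDriftEstimator ξ ∧ ∀ t, ∃ Y : PathSpace T → ℝ,
    IsWienerIntegral M (opInv (Γτ + Γ) (Γτ (chi t))) Y ∧
    ∀ᵐ ω ∂M, ξ t ω = inner ℝ (opInv (Γτ + Γ) (Γ (chi t))) v + Y ω

end GaussianDrift

end

open GaussianDrift

noncomputable section

namespace GaussianDrift

variable {T : ℝ}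

/-! The signal `z` (law `Q`) and the noise `x` (law `P`) are independent and Gaussian, and `z + x`
is observed. The `χ_t` span a dense subspace, so evaluations extend to continuous linear Gaussian
maps `JQ`, `JP`, `JM` on `DriftSpace T` for the laws of signal, noise and observation
(`IsGaussianPathLaw.exists_isGaussianMap`). All variables needed then lie in the Gaussian space of
`JQ f (z) + JP g (x)`.

Put `S = Γτ + Γ` and `g_t = S⁻¹ Γτ χ_t`. The normal equation `S g_t = Γτ χ_t` says exactly that the
residual `z_t - X(g_t)` is uncorrelated with every observed `X_s`. By joint Gaussianity it is
independent of the whole observed path (`indepFun_residual`). Its mean is `⟨χ_t - g_t, v⟩` with `χ_t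
- g_t = S⁻¹ Γ χ_t`, so the estimator is the posterior mean of `z_t`; the residual variance is `⟨χ_t,
Γ g_t⟩`.

Pythagoras (`lintegral_sq_error_eq`) splits the error of any estimator into its squared distance to
the posterior mean plus this variance. Integrated against `μ`, the Bayes risk is a squared distance
plus a finite constant, which gives the optimal value and uniqueness. Admissibility follows because
pointwise domination of risks integrates to domination of Bayes risks.

Two points need separate care: a version jointly measurable in time and path
(`exists_isDriftEstimator_ae_eq`), and the symmetry of `S⁻¹ Γ` when `S⁻¹` may be unbounded
(`inner_eq_inner_of_commute`). -/

/-! ### Totality of the `χ_t`, and the covariance of a Volterra kernel -/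

/-- The intervals `[0, t]` form a π-system generating the Borel sets, so vanishing integrals over
them propagate to all measurable sets; `t = T` supplies the whole space for complements. -/
theorem eq_zero_of_toFun_eq_zero {h : DriftSpace T} (h0 : ∀ t, toFun h t = 0) : h = 0 := by
  rcases isEmpty_or_nonempty (TimeInterval T) with hT | ⟨⟨t₀⟩⟩
  · apply Lp.ext
    exact Eventually.of_forall fun x => (hT.false x).elim
  have hT : (0 : ℝ) ≤ T := t₀.2.1.trans t₀.2.2
  have hint : Integrable h (leb T) := (Lp.memLp h).integrable one_le_two
  have huniv : ∫ s, h s ∂(leb T) = 0 := by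
    have h1 := h0 ⟨T, hT, le_rfl⟩
    have h2 : Set.Iic (⟨T, hT, le_rfl⟩ : TimeInterval T) = Set.univ :=
      Set.eq_univ_of_forall fun s => s.2.2
    rwa [toFun, h2, Measure.restrict_univ] at h1
  rw [Lp.eq_zero_iff_ae_eq_zero]
  refine hint.ae_eq_zero_of_forall_setIntegral_eq_zero fun s hs _ => ?_
  induction s, hs using MeasurableSpace.induction_on_inter
    (s := Set.range (Set.Iic : TimeInterval T → Set (TimeInterval T))) with
  | h_eq => exact (BorelSpace.measurable_eq).trans (borel_eq_generateFrom_Iic _)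
  | h_inter =>
    rintro _ ⟨a, rfl⟩ _ ⟨b, rfl⟩ -
    exact ⟨min a b, Set.Iic_inter_Iic.symm⟩
  | empty => simp
  | basic s hs =>
    obtain ⟨t, rfl⟩ := hs
    exact h0 t
  | compl s hs ih =>
    have := integral_add_compl hs hint
    rw [ih (measure_lt_top _ _), huniv] at this
    linarith
  | iUnion f hd hm ih =>
    rw [integral_iUnion hm hd hint.integrableOn]
    simp [ih]

theorem denseRange_linearCombination_chi :
    DenseRange (Finsupp.linearCombination ℝ (chi : TimeInterval T → DriftSpace T)) := by
  have h1 : (Submodule.span ℝ (Set.range (chi : TimeInterval T → DriftSpace T)))ᗮ = ⊥ := by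
    rw [Submodule.eq_bot_iff]
    intro h hh
    refine eq_zero_of_toFun_eq_zero fun t => ?_
    rw [← inner_chi]
    exact hh _ (Submodule.subset_span ⟨t, rfl⟩)
  rw [← Submodule.topologicalClosure_eq_top_iff, ← Finsupp.range_linearCombination] at h1
  intro x
  have h2 : x ∈ (LinearMap.range
      (Finsupp.linearCombination ℝ (chi : TimeInterval T → DriftSpace T))).topologicalClosure := by
    rw [h1]; trivial
  rwa [← SetLike.mem_coe, Submodule.topologicalClosure_coe, LinearMap.coe_range] at h2

/-- Pairing with an arbitrary `h` turns `(K h)(t)` into an `L²` inner product, from which the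
representing function is read off. -/
theorem IsVolterraOperator.adjoint_chi {k : TimeInterval T → TimeInterval T → ℝ}
    {K : DriftSpace T →L[ℝ] DriftSpace T} (hK : IsVolterraOperator k K) (t : TimeInterval T) :
    (ContinuousLinearMap.adjoint K (chi t) : TimeInterval T → ℝ) =ᵐ[leb T]
      (Set.Iic t).indicator (k t) := by
  have hm : MemLp ((Set.Iic t).indicator (k t)) 2 (leb T) :=
    (memLp_indicator_iff_restrict measurableSet_Iic).2 (hK.memLp t)
  suffices ContinuousLinearMap.adjoint K (chi t) = hm.toLp _ from this ▸ hm.coeFn_toLp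
  refine ext_inner_right ℝ fun h => ?_
  rw [ContinuousLinearMap.adjoint_inner_left, inner_chi, hK.apply_eq, L2.inner_def,
    ← integral_indicator measurableSet_Iic]
  refine integral_congr_ae ?_
  filter_upwards [hm.coeFn_toLp] with s hs
  rw [hs]
  by_cases hst : s ∈ Set.Iic t <;> simp [hst, mul_comm]

theorem IsVolterraOperator.kernelCov_eq {k : TimeInterval T → TimeInterval T → ℝ}
    {K : DriftSpace T →L[ℝ] DriftSpace T} (hK : IsVolterraOperator k K) (s t : TimeInterval T) :
    kernelCov k s t =
      inner ℝ (chi s) ((K ∘L ContinuousLinearMap.adjoint K) (chi t)) := by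
  rw [ContinuousLinearMap.comp_apply, ← ContinuousLinearMap.adjoint_inner_left, L2.inner_def,
    kernelCov, ← integral_indicator measurableSet_Iic]
  refine integral_congr_ae ?_
  filter_upwards [hK.adjoint_chi s, hK.adjoint_chi t] with r h1 h2
  rw [h1, h2]
  by_cases hs : r ≤ s <;> by_cases ht : r ≤ t <;> simp [hs, ht, mul_comm]

/-! ### Injective positive operators and their resolvents -/

section Commuting

variable {H : Type*} [NormedAddCommGroup H] [InnerProductSpace ℝ H] [CompleteSpace H]

theorem denseRange_of_isPositive_of_injective {S : H →L[ℝ] H} (hS : S.IsPositive)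
    (hinj : Function.Injective S) : DenseRange S := by
  have h1 : (LinearMap.range (S : H →ₗ[ℝ] H))ᗮ = ⊥ := by
    rw [Submodule.eq_bot_iff]
    intro h hh
    apply hinj
    rw [map_zero]
    refine ext_inner_left ℝ fun y => ?_
    rw [inner_zero_right, ← hS.inner_left_eq_inner_right]
    exact hh _ ⟨y, rfl⟩
  rw [← Submodule.topologicalClosure_eq_top_iff] at h1
  intro x
  have h2 : x ∈ (LinearMap.range (S : H →ₗ[ℝ] H)).topologicalClosure := by rw [h1]; trivial
  rwa [← SetLike.mem_coe, Submodule.topologicalClosure_coe, LinearMap.coe_range] at h2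

/-- Positivity makes `S + ε` coercive with constant `ε`, hence invertible. -/
theorem exists_resolvent {S : H →L[ℝ] H} (hS : S.IsPositive) {ε : ℝ} (hε : 0 < ε) (a : H) :
    ∃ p, S p + ε • p = a := by
  have hu : IsUnit (S + ε • (1 : H →L[ℝ] H)) := by
    refine ContinuousLinearMap.isUnit_of_forall_le_norm_inner_map _ (c := ε.toNNReal)
      (by simpa using hε) fun x => ?_
    have h1 := hS.inner_nonneg_left x
    have h2 : inner ℝ ((S + ε • (1 : H →L[ℝ] H)) x) x = inner ℝ (S x) x + ε * ‖x‖ ^ 2 := by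
      simp [inner_add_left, inner_smul_left]
    rw [h2, Real.coe_toNNReal _ hε.le, Real.norm_eq_abs]
    exact le_trans (by linarith) (le_abs_self _)
  obtain ⟨p, hp⟩ := ((ContinuousLinearMap.isUnit_iff_bijective).1 hu).2 a
  exact ⟨p, by simpa using hp⟩

omit [CompleteSpace H] in
theorem norm_smul_le_of_resolvent {S : H →L[ℝ] H} (hS : S.IsPositive) {ε : ℝ} (hε : 0 < ε)
    {a p : H} (hp : S p + ε • p = a) : ‖ε • p‖ ≤ ‖a‖ := by
  rw [norm_smul, Real.norm_of_nonneg hε.le]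
  rcases eq_or_ne p 0 with rfl | hp0
  · simp
  have h1 := hS.inner_nonneg_left p
  have h2 : inner ℝ a p = inner ℝ (S p) p + ε * ‖p‖ ^ 2 := by
    simp [← hp, inner_add_left, inner_smul_left]
  have h3 := real_inner_le_norm a p
  have h4 : 0 < ‖p‖ := norm_pos_iff.2 hp0
  nlinarith

/-- The range of `S` is dense. If `S w` is close to `a`, then `p ε - w` solves the resolvent
equation with right side `a - S w - ε w`, whose norm bounds that of `ε (p ε - w)`. -/
theorem tendsto_smul_resolvent {S : H →L[ℝ] H} (hS : S.IsPositive)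
    (hinj : Function.Injective S) {p : ℝ → H} {a : H}
    (hp : ∀ ε, 0 < ε → S (p ε) + ε • p ε = a) :
    Tendsto (fun ε => ε • p ε) (𝓝[>] 0) (𝓝 0) := by
  rw [Metric.tendsto_nhds]
  intro δ hδ
  obtain ⟨w, hw⟩ : ∃ w, ‖a - S w‖ < δ / 2 := by
    obtain ⟨w, hw⟩ := (denseRange_of_isPositive_of_injective hS hinj).exists_dist_lt a
      (half_pos hδ)
    exact ⟨w, by rwa [← dist_eq_norm]⟩
  have hsmall : ∀ᶠ ε in 𝓝[>] (0 : ℝ), ε * (2 * ‖w‖) < δ / 2 := by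
    have : Tendsto (fun ε : ℝ => ε * (2 * ‖w‖)) (𝓝[>] 0) (𝓝 (0 * (2 * ‖w‖))) :=
      ((continuous_id.mul continuous_const).tendsto 0).mono_left nhdsWithin_le_nhds
    rw [zero_mul] at this
    exact this.eventually (gt_mem_nhds (half_pos hδ))
  filter_upwards [hsmall, self_mem_nhdsWithin] with ε h1 hε
  have hε : 0 < ε := hε
  have h2 : S (p ε - w) + ε • (p ε - w) = (a - S w) - ε • w := by
    rw [← hp ε hε, map_sub, smul_sub]
    abel
  have h3 := norm_smul_le_of_resolvent hS hε h2
  have h4 : ‖(a - S w) - ε • w‖ ≤ ‖a - S w‖ + ε * ‖w‖ := by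
    refine (norm_sub_le _ _).trans ?_
    rw [norm_smul, Real.norm_of_nonneg hε.le]
  have h5 : ‖ε • p ε‖ ≤ ‖ε • (p ε - w)‖ + ε * ‖w‖ := by
    have : ε • p ε = ε • (p ε - w) + ε • w := by rw [smul_sub]; abel
    rw [this]
    refine (norm_add_le _ _).trans ?_
    rw [norm_smul ε w, Real.norm_of_nonneg hε.le]
  rw [dist_zero_right]
  linarith

/-- If `G` commutes with the injective positive operator `S`, then `S⁻¹ G` is symmetric. -/
theorem inner_eq_inner_of_commute {S G : H →L[ℝ] H} (hS : S.IsPositive)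
    (hinj : Function.Injective S) (hG : IsSelfAdjoint G) (hc : Commute G S) {a b x y : H}
    (ha : S a = G x) (hb : S b = G y) : inner ℝ a y = inner ℝ x b := by
  have hcomm : ∀ z, G (S z) = S (G z) := fun z => congrArg (fun A : H →L[ℝ] H => A z) hc
  have hsymm : ∀ u w, inner ℝ (G u) w = inner ℝ u (G w) := fun u w => by
    rw [← ContinuousLinearMap.adjoint_inner_right, hG.adjoint_eq]
  -- `x` and `y` need not lie in the range of `S`, so the symmetry is first shown with `a`, `b`
  -- replaced by `S (S + ε)⁻¹ a`, `S (S + ε)⁻¹ b`; then `ε → 0`.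
  have key : ∀ ε : ℝ, 0 < ε → ∀ p q, S p + ε • p = a → S q + ε • q = b →
      inner ℝ (a - ε • p) y = inner ℝ x (b - ε • q) := by
    intro ε hε p q hp hq
    obtain ⟨u, hu⟩ := exists_resolvent hS hε y
    obtain ⟨w, hw⟩ := exists_resolvent hS hε x
    -- `(S + ε)⁻¹` commutes with `S` and `G`: the two vectors solve the same resolvent equation,
    -- whose solution is unique.
    have hres : ∀ {c d r z : H}, S c = G d → S r + ε • r = c → S z + ε • z = d →
        S r = G z := by
      intro c d r z hcd hr hz
      have h0 : S (S r - G z) + ε • (S r - G z) = 0 := by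
        have h1 : S (S r) + ε • S r = G (S z) + ε • G z := by
          rw [← map_smul, ← map_add, hr, hcd, ← hz, map_add, map_smul]
        rw [hcomm] at h1
        rw [map_sub, smul_sub]
        rw [← sub_eq_zero] at h1
        rw [← h1]
        abel
      have h1 := norm_smul_le_of_resolvent hS hε h0
      rw [norm_zero, norm_le_zero_iff, smul_eq_zero] at h1
      exact sub_eq_zero.1 (h1.resolve_left hε.ne')
    have e1 : a - ε • p = G w := by rw [← hres ha hp hw, ← hp]; abel
    have e2 : b - ε • q = G u := by rw [← hres hb hq hu, ← hq]; abel
    rw [e1, e2, ← hu, ← hw]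
    simp only [hsymm, map_add, map_smul, inner_add_left, inner_add_right, inner_smul_left,
      inner_smul_right, hcomm, hS.inner_left_eq_inner_right]
    simp
  choose! p hp using fun ε (hε : 0 < ε) => exists_resolvent hS hε a
  choose! q hq using fun ε (hε : 0 < ε) => exists_resolvent hS hε b
  have h1 : Tendsto (fun ε => inner ℝ (a - ε • p ε) y) (𝓝[>] 0) (𝓝 (inner ℝ (a - 0) y)) :=
    (tendsto_const_nhds.sub (tendsto_smul_resolvent hS hinj hp)).inner tendsto_const_nhds
  have h2 : Tendsto (fun ε => inner ℝ x (b - ε • q ε)) (𝓝[>] 0) (𝓝 (inner ℝ x (b - 0))) :=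
    tendsto_const_nhds.inner (tendsto_const_nhds.sub (tendsto_smul_resolvent hS hinj hq))
  have h3 := tendsto_nhds_unique (h1.congr' (by
    filter_upwards [self_mem_nhdsWithin] with ε hε
    exact key ε hε _ _ (hp ε hε) (hq ε hε))) h2
  simpa using h3

end Commuting

/-! ### Gaussian variables as a closed set in `L²` -/

section GaussianLp

variable {Ω : Type*} [MeasurableSpace Ω] {ρ : Measure Ω} [IsProbabilityMeasure ρ]

omit [IsProbabilityMeasure ρ] in
theorem Lp_inner_eq_integral (f g : Lp ℝ 2 ρ) : inner ℝ f g = ∫ ω, (f * g : Ω → ℝ) ω ∂ρ := by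
  rw [L2.inner_def]
  exact integral_congr_ae (Eventually.of_forall fun ω => by simp [mul_comm])

theorem continuous_integral_Lp_two : Continuous fun f : Lp ℝ 2 ρ => ∫ ω, f ω ∂ρ := by
  have h : (fun f : Lp ℝ 2 ρ => ∫ ω, f ω ∂ρ) =
      fun f => inner ℝ (indicatorConstLp 2 MeasurableSet.univ (measure_ne_top ρ Set.univ) (1 : ℝ))
        f := by
    ext f
    rw [L2.inner_indicatorConstLp_one, Measure.restrict_univ]
  rw [h]
  fun_prop

theorem covariance_Lp (f g : Lp ℝ 2 ρ) :
    cov[f, g; ρ] = inner ℝ f g - (∫ ω, f ω ∂ρ) * ∫ ω, g ω ∂ρ := by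
  rw [covariance_eq_sub (Lp.memLp f) (Lp.memLp g), Lp_inner_eq_integral]

theorem continuous_variance_Lp : Continuous fun f : Lp ℝ 2 ρ => Var[f; ρ] := by
  have h : (fun f : Lp ℝ 2 ρ => Var[f; ρ]) =
      fun f => inner ℝ f f - (∫ ω, f ω ∂ρ) * ∫ ω, f ω ∂ρ := by
    ext f
    rw [← covariance_self (Lp.aestronglyMeasurable f).aemeasurable, covariance_Lp]
  rw [h]
  have := continuous_integral_Lp_two (ρ := ρ)
  fun_prop

theorem integral_abs_Lp_two_le (f : Lp ℝ 2 ρ) : ∫ ω, |f ω| ∂ρ ≤ ‖f‖ := by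
  have h1 : MemLp (f : Ω → ℝ) 1 ρ := (Lp.memLp f).mono_exponent one_le_two
  have h2 := eLpNorm_le_eLpNorm_of_exponent_le (μ := ρ) one_le_two (Lp.aestronglyMeasurable f)
  have h3 : ∫ ω, |f ω| ∂ρ = (eLpNorm f 1 ρ).toReal := by
    rw [eLpNorm_one_eq_lintegral_enorm]
    exact integral_norm_eq_lintegral_enorm h1.1
  rw [h3, Lp.norm_def]
  exact ENNReal.toReal_mono (Lp.eLpNorm_ne_top f) h2

/-- Lipschitz in `f` because `|exp(ia) - exp(ib)| ≤ |a - b|` and the `L¹` norm is at most the `L²`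
norm. -/
theorem continuous_charFun_map_Lp (t : ℝ) :
    Continuous fun f : Lp ℝ 2 ρ => charFun (ρ.map f) t := by
  have hval : ∀ f : Lp ℝ 2 ρ,
      charFun (ρ.map f) t = ∫ ω, Complex.exp (t * f ω * Complex.I) ∂ρ := fun f => by
    rw [charFun_apply_real, integral_map (Lp.aestronglyMeasurable f).aemeasurable (by fun_prop)]
  have hint : ∀ f : Lp ℝ 2 ρ, Integrable (fun ω => Complex.exp (t * f ω * Complex.I)) ρ :=
    fun f => by
      refine Integrable.of_bound (C := 1) ?_ (Eventually.of_forall fun ω => ?_)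
      · have := Lp.aestronglyMeasurable f
        have h2 : Continuous fun x : ℝ => Complex.exp (t * x * Complex.I) := by fun_prop
        exact h2.comp_aestronglyMeasurable this
      · rw [← Complex.ofReal_mul, Complex.norm_exp_ofReal_mul_I]
  have hlip : LipschitzWith ‖t‖₊ fun f : Lp ℝ 2 ρ => charFun (ρ.map f) t := by
    refine LipschitzWith.of_dist_le_mul fun f g => ?_
    rw [hval, hval, dist_eq_norm, ← integral_sub (hint f) (hint g), dist_eq_norm]
    refine (norm_integral_le_integral_norm _).trans ?_
    refine le_trans (integral_mono_ae (g := fun ω => ‖t‖ * |(f - g : Lp ℝ 2 ρ) ω|)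
      ((hint f).sub (hint g)).norm ?_ ?_) ?_
    · exact (((Lp.memLp (f - g)).integrable one_le_two).abs).const_mul _
    · filter_upwards [Lp.coeFn_sub f g] with ω hω
      rw [hω, Pi.sub_apply]
      have h1 : Complex.exp (t * f ω * Complex.I) - Complex.exp (t * g ω * Complex.I) =
          Complex.exp ((t * g ω : ℝ) * Complex.I) *
            (Complex.exp (Complex.I * (t * (f ω - g ω) : ℝ)) - 1) := by
        rw [mul_sub, ← Complex.exp_add, mul_one]
        push_cast
        ring_nf
      rw [h1, norm_mul, Complex.norm_exp_ofReal_mul_I, one_mul]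
      refine Real.norm_exp_I_mul_ofReal_sub_one_le.trans ?_
      rw [norm_mul, Real.norm_eq_abs (f ω - g ω)]
    · rw [integral_const_mul, coe_nnnorm]
      exact mul_le_mul_of_nonneg_left (integral_abs_Lp_two_le _) (norm_nonneg _)
  exact hlip.continuous

/-- Gaussianity is an equation between characteristic function, mean and variance for each `t`, and
all three are continuous in `L²`. -/
theorem isClosed_setOf_hasGaussianLaw : IsClosed {f : Lp ℝ 2 ρ | HasGaussianLaw f ρ} := by
  have h : {f : Lp ℝ 2 ρ | HasGaussianLaw f ρ} = ⋂ t : ℝ, {f : Lp ℝ 2 ρ | charFun (ρ.map f) t =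
      Complex.exp ((t * ∫ ω, f ω ∂ρ : ℝ) * Complex.I - (t ^ 2 * Var[f; ρ] : ℝ) / 2)} := by
    ext f
    have hf := (Lp.aestronglyMeasurable f).aemeasurable
    simp only [Set.mem_ofPred_eq, Set.mem_iInter]
    rw [hasGaussianLaw_iff_charFun_map_eq hf]
    refine forall_congr' fun t => ?_
    have h1 : (fun ω => inner ℝ t (f ω)) = fun ω => t * f ω := by
      ext ω; simp [mul_comm]
    rw [h1, integral_const_mul, variance_const_mul]
  rw [h]
  refine isClosed_iInter fun t => isClosed_eq (continuous_charFun_map_Lp t) ?_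
  have h1 := continuous_integral_Lp_two (ρ := ρ)
  have h2 := continuous_variance_Lp (ρ := ρ)
  fun_prop

-- Any linear functional of finitely many coordinates is again a value of `Ψ`, so one-dimensional
-- Gaussianity on the image of `Ψ` gives joint Gaussianity.
omit [IsProbabilityMeasure ρ] in
theorem isGaussianProcess_of_linearMap {S E : Type*} [AddCommGroup E] [Module ℝ E]
    {Ψ : E →ₗ[ℝ] Lp ℝ 2 ρ} (hΨ : ∀ v, HasGaussianLaw (Ψ v) ρ) {X : S → Ω → ℝ} {v : S → E}
    (hX : ∀ s, X s =ᵐ[ρ] Ψ (v s)) : IsGaussianProcess X ρ where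
  hasGaussianLaw I := by
    classical
    have hmeas : ∀ s, AEMeasurable (X s) ρ := fun s =>
      (Lp.aestronglyMeasurable (Ψ (v s))).aemeasurable.congr (hX s).symm
    have hmI : AEMeasurable (fun ω => I.restrict fun s => X s ω) ρ :=
      aemeasurable_pi_lambda _ fun s => hmeas s
    refine ⟨isGaussian_of_map_eq_gaussianReal fun L => ?_⟩
    have hL : (L ∘ fun ω => I.restrict fun s => X s ω) =ᵐ[ρ]
        Ψ (∑ i : I, L (Pi.single i 1) • v i) := by
      have h1 : (Ψ (∑ i : I, L (Pi.single i 1) • v i) : Ω → ℝ) =ᵐ[ρ]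
          ∑ i : I, (L (Pi.single i 1) • (Ψ (v i) : Ω → ℝ)) := by
        rw [map_sum]
        refine (Lp.coeFn_finsetSum _ _).trans ?_
        have h2 : ∀ i : I, (Ψ (L (Pi.single i 1) • v i) : Ω → ℝ) =ᵐ[ρ]
            L (Pi.single i 1) • (Ψ (v i) : Ω → ℝ) := fun i => by
          rw [map_smul]
          exact Lp.coeFn_smul _ _
        filter_upwards [eventually_countable_forall.2 h2] with ω hω
        simp only [Finset.sum_apply]
        exact Finset.sum_congr rfl fun i _ => hω i
      have h3 : ∀ᵐ ω ∂ρ, ∀ i : I, X i ω = Ψ (v i) ω :=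
        eventually_countable_forall.2 fun i => hX i
      filter_upwards [h1, h3] with ω h1 h3
      rw [h1]
      have h4 : (I.restrict fun s => X s ω) = ∑ i : I, (X i ω) • (Pi.single i (1 : ℝ)) := by
        ext j
        simp [Finset.sum_apply, Pi.single_apply]
      simp only [Function.comp_apply, h4, map_sum, map_smul, Finset.sum_apply, Pi.smul_apply,
        smul_eq_mul]
      exact Finset.sum_congr rfl fun i _ => by rw [h3 i, mul_comm]
    have hg := (hΨ (∑ i : I, L (Pi.single i 1) • v i)).congr hL.symm
    exact ⟨_, _, by
      rw [AEMeasurable.map_map_of_aemeasurable (by fun_prop) hmI, hg.map_eq_gaussianReal]⟩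

end GaussianLp

/-! ### The Gaussian map `h ↦ X(h)` -/

/-- `J` is the isonormal-type Gaussian map `h ↦ X(h)` under the law `N` with mean element `m` and
covariance operator `A`. -/
structure IsGaussianMap (N : Measure (PathSpace T)) (m : DriftSpace T)
    (A : DriftSpace T →L[ℝ] DriftSpace T) (J : DriftSpace T →L[ℝ] Lp ℝ 2 N) : Prop where
  apply_chi : ∀ t, J (chi t) =ᵐ[N] fun ω => ω t
  hasGaussianLaw : ∀ h, HasGaussianLaw (J h) N
  integral_eq : ∀ h, ∫ ω, J h ω ∂N = inner ℝ h m
  inner_eq : ∀ f g, inner ℝ (J f) (J g) = inner ℝ f (A g) + inner ℝ f m * inner ℝ g m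

theorem IsGaussianPathLaw.exists_isGaussianMap {N : Measure (PathSpace T)} {m : DriftSpace T}
    {A : DriftSpace T →L[ℝ] DriftSpace T}
    (hN : IsGaussianPathLaw N (toFun m) (fun s t => inner ℝ (chi s) (A (chi t)))) :
    ∃ J, IsGaussianMap N m A J := by
  have := hN.isProbability
  have hmem : ∀ t : TimeInterval T, MemLp (fun ω : PathSpace T => ω t) 2 N := fun t =>
    (hN.gaussian.hasGaussianLaw_eval t).memLp_two
  let ev : TimeInterval T → Lp ℝ 2 N := fun t => (hmem t).toLp _
  let F := Finsupp.linearCombination ℝ ev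
  let e := Finsupp.linearCombination ℝ (chi : TimeInterval T → DriftSpace T)
  have hev : ∀ t, ev t =ᵐ[N] fun ω => ω t := fun t => (hmem t).coeFn_toLp
  have hF : ∀ c, F c =ᵐ[N] fun ω => ∑ t ∈ c.support, c t * ω t := fun c => by
    have h1 : F c = ∑ t ∈ c.support, c t • ev t := Finsupp.linearCombination_apply _ _
    rw [h1]
    refine (Lp.coeFn_finsetSum _ _).trans ?_
    have h2 : ∀ᵐ ω ∂N, ∀ t : c.support, (c t • ev t : Lp ℝ 2 N) ω = c t * ω t :=
      eventually_countable_forall.2 fun t => by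
        filter_upwards [Lp.coeFn_smul (c t) (ev t), hev t] with ω h1 h2
        rw [h1, Pi.smul_apply, h2, smul_eq_mul]
    filter_upwards [h2] with ω hω
    rw [Finset.sum_apply]
    exact Finset.sum_congr rfl fun t ht => hω ⟨t, ht⟩
  have hgauss : ∀ c, HasGaussianLaw (F c) N := fun c =>
    ((hN.gaussian.smul c).hasGaussianLaw_fun_sum (I := c.support)).congr (hF c).symm
  have hevint : ∀ t, ∫ ω, ev t ω ∂N = inner ℝ (chi t) m := fun t => by
    rw [integral_congr_ae (hev t), hN.mean, inner_chi]
  have hevinner : ∀ s t, inner ℝ (ev s) (ev t) =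
      inner ℝ (chi s) (A (chi t)) + inner ℝ (chi s) m * inner ℝ (chi t) m := fun s t => by
    have h1 := hN.cov s t
    rw [covariance_eq_sub (hmem s) (hmem t), hN.mean, hN.mean, ← inner_chi, ← inner_chi] at h1
    rw [← h1, Lp_inner_eq_integral, sub_add_cancel]
    refine integral_congr_ae ?_
    filter_upwards [hev s, hev t] with ω h1 h2
    simp only [Pi.mul_apply, h1, h2]
  have hFinner : ∀ c d, inner ℝ (F c) (F d) =
      inner ℝ (e c) (A (e d)) + inner ℝ (e c) m * inner ℝ (e d) m := fun c d => by
    induction c using Finsupp.induction_linear with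
    | zero => simp
    | add c c' h h' => simp only [map_add, inner_add_left, h, h']; ring
    | single s a =>
      induction d using Finsupp.induction_linear with
      | zero => simp
      | add d d' h h' => simp only [map_add, inner_add_left, inner_add_right, h, h']; ring
      | single t b =>
        simp only [F, e, Finsupp.linearCombination_single, inner_smul_left, inner_smul_right,
          map_smul, hevinner]
        simp
        ring
  have hdense : DenseRange e := denseRange_linearCombination_chi
  have hbound : ∃ C, ∀ c, ‖F c‖ ≤ C * ‖e c‖ := by
    -- By Cauchy–Schwarz in `‖F c‖² = ⟨e c, A (e c)⟩ + ⟨e c, m⟩²`. The bound also shows that `F c`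
    -- depends only on `e c`, so the extension is well defined.
    refine ⟨√(‖A‖ + ‖m‖ ^ 2), fun c => ?_⟩
    refine le_of_sq_le_sq ?_ (by positivity)
    rw [mul_pow, Real.sq_sqrt (by positivity), ← real_inner_self_eq_norm_sq, hFinner]
    have h1 : inner ℝ (e c) (A (e c)) ≤ ‖e c‖ * (‖A‖ * ‖e c‖) :=
      (real_inner_le_norm _ _).trans
        (mul_le_mul_of_nonneg_left (A.le_opNorm _) (norm_nonneg _))
    have h2 := abs_real_inner_le_norm (e c) m
    have h3 : inner ℝ (e c) m * inner ℝ (e c) m ≤ (‖e c‖ * ‖m‖) ^ 2 := by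
      rw [← pow_two]
      exact sq_le_sq' (by linarith [neg_abs_le (inner ℝ (e c) m)]) ((le_abs_self _).trans h2)
    nlinarith
  let J := F.extendOfNorm e
  have hJ : ∀ c, J (e c) = F c := F.extendOfNorm_eq hdense hbound
  have hechi : ∀ t, e (Finsupp.single t 1) = chi t := fun t => by simp [e]
  have hJchi : ∀ t, J (chi t) = ev t := fun t => by
    rw [← hechi, hJ]; simp [F]
  have hinner : ∀ f g, inner ℝ (J f) (J g) = inner ℝ f (A g) + inner ℝ f m * inner ℝ g m := by
    intro f g
    refine hdense.induction_on₂ (p := fun f g => inner ℝ (J f) (J g) =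
      inner ℝ f (A g) + inner ℝ f m * inner ℝ g m) (isClosed_eq (by fun_prop) (by fun_prop))
      (fun c d => ?_) f g
    rw [hJ, hJ, hFinner]
  refine ⟨J, fun t => hJchi t ▸ hev t, fun h => ?_, fun h => ?_, hinner⟩
  · refine hdense.induction_on (p := fun h => HasGaussianLaw (J h) N) h
      (isClosed_setOf_hasGaussianLaw.preimage J.continuous) fun c => ?_
    rw [hJ]
    exact hgauss c
  · have h1 : (fun h => ∫ ω, J h ω ∂N) = fun h => inner ℝ h m := by
      refine hdense.equalizer (continuous_integral_Lp_two.comp J.continuous) (by fun_prop) ?_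
      ext c
      simp only [Function.comp_apply, hJ]
      rw [integral_congr_ae (hF c), integral_finsetSum _ fun t _ =>
        ((hmem t).integrable one_le_two).const_mul _]
      simp only [integral_const_mul, hN.mean]
      simp only [e, Finsupp.linearCombination_apply, Finsupp.sum, sum_inner, inner_smul_left,
        inner_chi]
      simp
    exact congrFun h1 h

/-- Continuity of `J` makes the `L²` limit independent of the approximating combinations; density of
the `χ_t` provides such combinations. -/
theorem IsGaussianMap.isWienerIntegral_iff {N : Measure (PathSpace T)} {m : DriftSpace T}
    {A : DriftSpace T →L[ℝ] DriftSpace T} {J : DriftSpace T →L[ℝ] Lp ℝ 2 N}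
    (hJ : IsGaussianMap N m A J) {h : DriftSpace T} {Y : PathSpace T → ℝ} :
    IsWienerIntegral N h Y ↔ Y =ᵐ[N] J h := by
  have hsum : ∀ c : TimeInterval T →₀ ℝ, J (c.sum fun t a => a • chi t) =ᵐ[N]
      fun ω => c.sum fun t a => a * ω t := fun c => by
    rw [Finsupp.sum, map_sum]
    refine (Lp.coeFn_finsetSum _ _).trans ?_
    have h2 : ∀ᵐ ω ∂N, ∀ t : c.support, (J (c t • chi (t : TimeInterval T))) ω = c t * ω t :=
      eventually_countable_forall.2 fun t => by
        rw [map_smul]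
        filter_upwards [Lp.coeFn_smul (c t) (J (chi t)), hJ.apply_chi t] with ω h1 h2
        rw [h1, Pi.smul_apply, h2, smul_eq_mul]
    filter_upwards [h2] with ω hω
    rw [Finset.sum_apply, Finsupp.sum]
    exact Finset.sum_congr rfl fun t ht => hω ⟨t, ht⟩
  have hnorm : ∀ (c : TimeInterval T →₀ ℝ) {Z : PathSpace T → ℝ},
      eLpNorm ((J (c.sum fun t a => a • chi t) : PathSpace T → ℝ) - Z) 2 N =
      eLpNorm (fun ω => (c.sum fun t a => a * ω t) - Z ω) 2 N := fun c Z =>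
    eLpNorm_congr_ae ((hsum c).sub EventuallyEq.rfl)
  constructor
  · rintro ⟨hY, c, hc, hlim⟩
    have h1 : Tendsto (fun n => J ((c n).sum fun t a => a • chi t)) atTop (𝓝 (hY.toLp Y)) := by
      rw [Lp.tendsto_Lp_iff_tendsto_eLpNorm]
      exact hlim.congr fun n => (hnorm _).symm
    have h2 := tendsto_nhds_unique h1 ((J.continuous.tendsto h).comp hc)
    rw [← h2]
    exact hY.coeFn_toLp.symm
  · intro hY
    refine ⟨(memLp_congr_ae hY).2 (Lp.memLp _), ?_⟩
    obtain ⟨x, hx, hlim⟩ := mem_closure_iff_seq_limit.1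
      (denseRange_linearCombination_chi (T := T) h)
    choose c hc using hx
    have hc' : ∀ n, ((c n).sum fun t a => a • chi t) = x n := hc
    refine ⟨c, by simpa only [hc'] using hlim, ?_⟩
    have h1 : Tendsto (fun n => J ((c n).sum fun t a => a • chi t)) atTop (𝓝 (J h)) := by
      simp only [hc']
      exact (J.continuous.tendsto h).comp hlim
    rw [Lp.tendsto_Lp_iff_tendsto_eLpNorm'] at h1
    refine h1.congr fun n => ?_
    rw [hnorm]
    exact eLpNorm_congr_ae (EventuallyEq.rfl.sub hY.symm)

/-! ### Measurability on path space -/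

theorem measurable_pathSpace_iff {α : Type*} [MeasurableSpace α] {f : α → PathSpace T} :
    Measurable f ↔ ∀ t, Measurable fun a => f a t := by
  rw [pathMeasurableSpace, measurable_comap_iff, measurable_pi_iff]
  rfl

theorem measurable_eval (t : TimeInterval T) : Measurable fun ω : PathSpace T => ω t :=
  measurable_pathSpace_iff.1 measurable_id t

theorem measurable_add_pathSpace :
    Measurable fun p : PathSpace T × PathSpace T => p.1 + p.2 :=
  measurable_pathSpace_iff.2 fun t =>
    ((measurable_eval t).comp measurable_fst).add ((measurable_eval t).comp measurable_snd)

theorem measurable_uncurry_eval :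
    Measurable (Function.uncurry fun (t : TimeInterval T) (ω : PathSpace T) => ω t) :=
  measurable_uncurry_of_continuous_of_measurable (fun ω => ω.continuous) measurable_eval

/-- A closed ball is cut out by countably many evaluations, at a dense set of times, and
separability writes open sets as countable unions of balls. This makes the path space standard
Borel, so that regular conditional distributions exist. -/
instance instBorelSpacePathSpace : BorelSpace (PathSpace T) := by
  constructor
  refine le_antisymm ?_ ?_
  · rw [pathMeasurableSpace, ← measurable_iff_comap_le]
    let _ : MeasurableSpace (PathSpace T) := borel _
    have : BorelSpace (PathSpace T) := ⟨rfl⟩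
    exact measurable_pi_lambda _ fun t => (ContinuousEvalConst.continuous_eval_const t).measurable
  · have hball : ∀ (f : PathSpace T) (r : ℝ), 0 ≤ r →
        MeasurableSet[pathMeasurableSpace T] (Metric.closedBall f r) := by
      intro f r hr
      obtain ⟨D, hDc, hDd⟩ := TopologicalSpace.exists_countable_dense (TimeInterval T)
      have h1 : Metric.closedBall f r = ⋂ t ∈ D, {ω : PathSpace T | dist (ω t) (f t) ≤ r} := by
        ext ω
        simp only [Metric.mem_closedBall, Set.mem_iInter, Set.mem_ofPred_eq]
        rw [ContinuousMap.dist_le hr]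
        refine ⟨fun h t _ => h t, fun h t => ?_⟩
        have hcl : IsClosed {t : TimeInterval T | dist (ω t) (f t) ≤ r} :=
          isClosed_le (by fun_prop) continuous_const
        exact hcl.closure_subset_iff.2 (fun t ht => h t ht) (hDd t)
      rw [h1]
      refine MeasurableSet.biInter hDc fun t _ => ?_
      exact measurableSet_le ((measurable_eval t).dist measurable_const) measurable_const
    refine MeasurableSpace.generateFrom_le fun U hU => ?_
    have hU : IsOpen U := hU
    obtain ⟨D, hDc, hDd⟩ := TopologicalSpace.exists_countable_dense (PathSpace T)
    have h2 : U = ⋃ f ∈ D, ⋃ q ∈ {q : ℚ | 0 ≤ q ∧ Metric.closedBall f (q : ℝ) ⊆ U},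
        Metric.closedBall f (q : ℝ) := by
      refine Set.Subset.antisymm (fun ω hω => ?_) ?_
      · obtain ⟨ε, hε, hεU⟩ := Metric.isOpen_iff.1 hU ω hω
        obtain ⟨q, hq0, hq⟩ := exists_rat_btwn (half_pos hε)
        obtain ⟨f, hfD, hf⟩ := hDd.exists_dist_lt ω hq0
        simp only [Set.mem_iUnion]
        refine ⟨f, hfD, q, ⟨by exact_mod_cast hq0.le, fun x hx => hεU ?_⟩, hf.le⟩
        rw [Metric.mem_closedBall] at hx
        rw [Metric.mem_ball]
        have := dist_triangle x f ω
        rw [dist_comm f ω] at this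
        linarith
      · exact Set.iUnion₂_subset fun f _ => Set.iUnion₂_subset fun q hq => hq.2
    rw [h2]
    exact MeasurableSet.biUnion hDc fun f _ => MeasurableSet.biUnion (Set.to_countable _)
      fun q hq => hball f q (by exact_mod_cast hq.1)

/-! ### Transfer of covariance and Gaussianity -/

section General

variable {Ω Ω' : Type*} [MeasurableSpace Ω] [MeasurableSpace Ω'] {ρ : Measure Ω} {ν : Measure Ω'}

theorem covariance_congr {X X' Y Y' : Ω → ℝ} (hX : X =ᵐ[ρ] X') (hY : Y =ᵐ[ρ] Y') :
    cov[X, Y; ρ] = cov[X', Y'; ρ] := by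
  rw [covariance, covariance, integral_congr_ae hX, integral_congr_ae hY]
  refine integral_congr_ae ?_
  filter_upwards [hX, hY] with ω h1 h2
  rw [h1, h2]

theorem covariance_comp_measurePreserving {φ : Ω → Ω'} (hφ : MeasurePreserving φ ρ ν)
    {X Y : Ω' → ℝ} (hX : AEStronglyMeasurable X ν) (hY : AEStronglyMeasurable Y ν) :
    cov[fun ω => X (φ ω), fun ω => Y (φ ω); ρ] = cov[X, Y; ν] := by
  obtain ⟨hm, rfl⟩ := hφ
  exact (covariance_map_fun hX hY hm.aemeasurable).symm

theorem hasGaussianLaw_comp_measurePreserving {φ : Ω → Ω'} (hφ : MeasurePreserving φ ρ ν)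
    {X : Ω' → ℝ} (hX : HasGaussianLaw X ν) : HasGaussianLaw (fun ω => X (φ ω)) ρ := by
  obtain ⟨hm, rfl⟩ := hφ
  have h := hX.isGaussian_map
  rw [AEMeasurable.map_map_of_aemeasurable hX.aemeasurable hm.aemeasurable] at h
  exact ⟨h⟩

end General

/-! ### The joint Gaussian space of signal and noise -/

section SignalNoise

variable {P Q : Measure (PathSpace T)} [IsProbabilityMeasure P] [IsProbabilityMeasure Q]

theorem measurePreserving_observation (P Q : Measure (PathSpace T)) :
    MeasurePreserving (fun p : PathSpace T × PathSpace T => p.1 + p.2) (Q.prod P)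
      (observationLaw P Q) :=
  ⟨measurable_add_pathSpace, rfl⟩

instance instIsProbabilityMeasureObservationLaw : IsProbabilityMeasure (observationLaw P Q) :=
  Measure.isProbabilityMeasure_map measurable_add_pathSpace.aemeasurable

/-- The linear map `(f, g) ↦ J_Q(f)(z) + J_P(g)(x)` for independent `z` and `x` of laws `Q`, `P`. -/
def signalNoiseMap (JQ : DriftSpace T →L[ℝ] Lp ℝ 2 Q) (JP : DriftSpace T →L[ℝ] Lp ℝ 2 P) :
    DriftSpace T × DriftSpace T →L[ℝ] Lp ℝ 2 (Q.prod P) :=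
  ((Lp.compMeasurePreservingₗᵢ ℝ Prod.fst
      (measurePreserving_fst (μ := Q) (ν := P))).toContinuousLinearMap ∘L JQ).coprod
    ((Lp.compMeasurePreservingₗᵢ ℝ Prod.snd
      (measurePreserving_snd (μ := Q) (ν := P))).toContinuousLinearMap ∘L JP)

theorem coeFn_signalNoiseMap (JQ : DriftSpace T →L[ℝ] Lp ℝ 2 Q)
    (JP : DriftSpace T →L[ℝ] Lp ℝ 2 P) (f g : DriftSpace T) :
    signalNoiseMap JQ JP (f, g) =ᵐ[Q.prod P] fun p => JQ f p.1 + JP g p.2 := by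
  have h1 := Lp.coeFn_compMeasurePreserving (JQ f) (measurePreserving_fst (μ := Q) (ν := P))
  have h2 := Lp.coeFn_compMeasurePreserving (JP g) (measurePreserving_snd (μ := Q) (ν := P))
  refine (Lp.coeFn_add _ _).trans ?_
  filter_upwards [h1, h2] with p h1 h2
  exact congrArg₂ (· + ·) h1 h2

variable {v : DriftSpace T} {A B : DriftSpace T →L[ℝ] DriftSpace T}
  {JQ : DriftSpace T →L[ℝ] Lp ℝ 2 Q} {JP : DriftSpace T →L[ℝ] Lp ℝ 2 P}

theorem hasGaussianLaw_signalNoiseMap (hJQ : IsGaussianMap Q v B JQ)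
    (hJP : IsGaussianMap P 0 A JP) (x : DriftSpace T × DriftSpace T) :
    HasGaussianLaw (signalNoiseMap JQ JP x) (Q.prod P) := by
  have hf := (Lp.aestronglyMeasurable (JQ x.1)).aemeasurable
  have hg := (Lp.aestronglyMeasurable (JP x.2)).aemeasurable
  have h1 : HasGaussianLaw (fun p : PathSpace T × PathSpace T => JQ x.1 p.1) (Q.prod P) :=
    hasGaussianLaw_comp_measurePreserving measurePreserving_fst (hJQ.hasGaussianLaw x.1)
  have h2 : HasGaussianLaw (fun p : PathSpace T × PathSpace T => JP x.2 p.2) (Q.prod P) :=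
    hasGaussianLaw_comp_measurePreserving measurePreserving_snd (hJP.hasGaussianLaw x.2)
  exact (iIndepFun.hasGaussianLaw_fun_add h1 h2 (indepFun_prod₀ hf hg)).congr
    (coeFn_signalNoiseMap JQ JP x.1 x.2).symm

theorem integral_signalNoiseMap (hJQ : IsGaussianMap Q v B JQ)
    (hJP : IsGaussianMap P 0 A JP) (x : DriftSpace T × DriftSpace T) :
    ∫ p, signalNoiseMap JQ JP x p ∂(Q.prod P) = inner ℝ x.1 v := by
  have hf := (Lp.memLp (JQ x.1)).integrable one_le_two
  have hg := (Lp.memLp (JP x.2)).integrable one_le_two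
  rw [integral_congr_ae (coeFn_signalNoiseMap JQ JP x.1 x.2),
    integral_add (hf.comp_fst P) (hg.comp_snd Q), integral_fun_fst, integral_fun_snd,
    hJQ.integral_eq, hJP.integral_eq]
  simp

theorem covariance_signalNoiseMap (hJQ : IsGaussianMap Q v B JQ)
    (hJP : IsGaussianMap P 0 A JP) (x y : DriftSpace T × DriftSpace T) :
    cov[signalNoiseMap JQ JP x, signalNoiseMap JQ JP y; Q.prod P] =
      inner ℝ x.1 (B y.1) + inner ℝ x.2 (A y.2) := by
  have hQ : ∀ f, MemLp (fun p : PathSpace T × PathSpace T => JQ f p.1) 2 (Q.prod P) :=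
    fun f => (Lp.memLp (JQ f)).comp_fst P
  have hP : ∀ f, MemLp (fun p : PathSpace T × PathSpace T => JP f p.2) 2 (Q.prod P) :=
    fun f => (Lp.memLp (JP f)).comp_snd Q
  have hcross : ∀ f g, cov[fun p : PathSpace T × PathSpace T => JQ f p.1, fun p => JP g p.2;
      Q.prod P] = 0 := fun f g => covariance_fst_snd_prod (Lp.memLp _) (Lp.memLp _)
  have hQQ : ∀ f g, cov[fun p : PathSpace T × PathSpace T => JQ f p.1, fun p => JQ g p.1;
      Q.prod P] = inner ℝ f (B g) := fun f g => by
    have h1 := covariance_Lp (JQ f) (JQ g)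
    rw [hJQ.inner_eq, hJQ.integral_eq, hJQ.integral_eq, add_sub_cancel_right] at h1
    rw [← h1]
    exact covariance_comp_measurePreserving measurePreserving_fst (Lp.aestronglyMeasurable _)
      (Lp.aestronglyMeasurable _)
  have hPP : ∀ f g, cov[fun p : PathSpace T × PathSpace T => JP f p.2, fun p => JP g p.2;
      Q.prod P] = inner ℝ f (A g) := fun f g => by
    have h1 := covariance_Lp (JP f) (JP g)
    rw [hJP.inner_eq, hJP.integral_eq, hJP.integral_eq, add_sub_cancel_right] at h1
    rw [← h1]
    exact covariance_comp_measurePreserving measurePreserving_snd (Lp.aestronglyMeasurable _)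
      (Lp.aestronglyMeasurable _)
  have hc : cov[signalNoiseMap JQ JP x, signalNoiseMap JQ JP y; Q.prod P] =
      cov[(fun p : PathSpace T × PathSpace T => JQ x.1 p.1) + (fun p => JP x.2 p.2),
        (fun p : PathSpace T × PathSpace T => JQ y.1 p.1) + (fun p => JP y.2 p.2); Q.prod P] :=
    covariance_congr (coeFn_signalNoiseMap JQ JP x.1 x.2) (coeFn_signalNoiseMap JQ JP y.1 y.2)
  rw [hc, covariance_add_left (hQ _) (hP _) ((hQ _).add (hP _)),
    covariance_add_right (hQ _) (hQ _) (hP _), covariance_add_right (hP _) (hQ _) (hP _),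
    hQQ, hPP, hcross, covariance_comm, hcross]
  ring

theorem signalNoiseMap_diag_chi (hJQ : IsGaussianMap Q v B JQ)
    (hJP : IsGaussianMap P 0 A JP) (t : TimeInterval T) :
    signalNoiseMap JQ JP (chi t, chi t) =ᵐ[Q.prod P] fun p => (p.1 + p.2) t := by
  filter_upwards [coeFn_signalNoiseMap JQ JP (chi t) (chi t),
    measurePreserving_fst.quasiMeasurePreserving.ae (hJQ.apply_chi t),
    measurePreserving_snd.quasiMeasurePreserving.ae (hJP.apply_chi t)] with p h1 h2 h3
  rw [h1, h2, h3]
  rfl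

theorem isGaussianPathLaw_observationLaw (hJQ : IsGaussianMap Q v B JQ)
    (hJP : IsGaussianMap P 0 A JP) :
    IsGaussianPathLaw (observationLaw P Q) (toFun v)
      (fun s t => inner ℝ (chi s) ((B + A) (chi t))) where
  isProbability := inferInstance
  gaussian := by
    have h := isGaussianProcess_of_linearMap (Ψ := (signalNoiseMap JQ JP).toLinearMap)
      (v := fun t => (chi t, chi t)) (hasGaussianLaw_signalNoiseMap hJQ hJP)
      (fun t => (signalNoiseMap_diag_chi hJQ hJP t).symm)
    refine ⟨fun I => ⟨?_⟩⟩
    have := (h.hasGaussianLaw I).isGaussian_map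
    rw [observationLaw, Measure.map_map (measurable_pi_lambda (fun (ω : PathSpace T) =>
      I.restrict fun t => ω t) fun t => measurable_eval _) measurable_add_pathSpace]
    exact this
  mean t := by
    rw [observationLaw, integral_map measurable_add_pathSpace.aemeasurable
      (measurable_eval t).aestronglyMeasurable,
      integral_congr_ae (signalNoiseMap_diag_chi hJQ hJP t).symm,
      integral_signalNoiseMap hJQ hJP, inner_chi]
  cov s t := by
    rw [observationLaw, covariance_map_fun (measurable_eval s).aestronglyMeasurable
      (measurable_eval t).aestronglyMeasurable measurable_add_pathSpace.aemeasurable,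
      covariance_congr (signalNoiseMap_diag_chi hJQ hJP s).symm
        (signalNoiseMap_diag_chi hJQ hJP t).symm, covariance_signalNoiseMap hJQ hJP,
      add_apply, inner_add_right]

/-- Both sides are continuous and linear in `h` and agree at each `χ_t`. This places `X(h)`, as a
function of signal and noise, on the diagonal of the joint Gaussian space. -/
theorem comp_observation_eq_signalNoiseMap (hJQ : IsGaussianMap Q v B JQ)
    (hJP : IsGaussianMap P 0 A JP) {C : DriftSpace T →L[ℝ] DriftSpace T}
    {JM : DriftSpace T →L[ℝ] Lp ℝ 2 (observationLaw P Q)}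
    (hJM : IsGaussianMap (observationLaw P Q) v C JM) (h : DriftSpace T) :
    (fun p : PathSpace T × PathSpace T => JM h (p.1 + p.2)) =ᵐ[Q.prod P]
      signalNoiseMap JQ JP (h, h) := by
  let W := (Lp.compMeasurePreservingₗᵢ (E := ℝ) (p := 2) ℝ _
    (measurePreserving_observation P Q)).toContinuousLinearMap
  have hW : ∀ h, W (JM h) =ᵐ[Q.prod P] fun p => JM h (p.1 + p.2) := fun h =>
    Lp.coeFn_compMeasurePreserving _ (measurePreserving_observation P Q)
  have heq : (fun h => W (JM h)) = fun h => signalNoiseMap JQ JP (h, h) := by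
    refine (denseRange_linearCombination_chi (T := T)).equalizer (by fun_prop) (by fun_prop) ?_
    ext1 c
    simp only [Function.comp_apply]
    induction c using Finsupp.induction_linear with
    | zero => simp only [map_zero, Prod.mk_zero_zero]
    | add c d hc hd =>
      rw [map_add, map_add, map_add, hc, hd, ← map_add, Prod.mk_add_mk]
    | single t a =>
      rw [Finsupp.linearCombination_single, map_smul, map_smul, ← Prod.smul_mk, map_smul]
      congr 1
      refine Lp.ext ?_
      refine (hW _).trans (EventuallyEq.trans ?_ (signalNoiseMap_diag_chi hJQ hJP t).symm)
      exact (measurePreserving_observation P Q).quasiMeasurePreserving.ae (hJM.apply_chi t)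
  rw [← congrFun heq h]
  exact (hW h).symm

end SignalNoise

/-! ### Pythagoras for independent errors in `[0, ∞]` -/

section Pythagoras

variable {Ω : Type*} [MeasurableSpace Ω] {ρ : Measure Ω}

theorem lintegral_sq_eq_top_of_not_memLp {D : Ω → ℝ} (hD : AEStronglyMeasurable D ρ)
    (h : ¬ MemLp D 2 ρ) : ∫⁻ ω, ENNReal.ofReal (D ω ^ 2) ∂ρ = ⊤ := by
  by_contra hne
  exact h ((memLp_two_iff_integrable_sq hD).2 ((lintegral_ofReal_ne_top_iff_integrable (hD.pow 2)
    (Eventually.of_forall fun ω => sq_nonneg (D ω))).1 hne))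

theorem lintegral_sq_sub_of_indepFun {D U : Ω → ℝ} (hind : IndepFun U D ρ)
    (hD : AEStronglyMeasurable D ρ) (hU : MemLp U 2 ρ) (h0 : ∫ ω, U ω ∂ρ = 0) :
    ∫⁻ ω, ENNReal.ofReal ((D ω - U ω) ^ 2) ∂ρ =
      ∫⁻ ω, ENNReal.ofReal (D ω ^ 2) ∂ρ + ∫⁻ ω, ENNReal.ofReal (U ω ^ 2) ∂ρ := by
  by_cases hD2 : MemLp D 2 ρ
  · have hDU := hD2.sub hU
    change ∫⁻ ω, ENNReal.ofReal ((D - U) ω ^ 2) ∂ρ = _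
    rw [← ofReal_integral_eq_lintegral_ofReal hDU.integrable_sq
        (Eventually.of_forall fun ω => sq_nonneg _),
      ← ofReal_integral_eq_lintegral_ofReal hD2.integrable_sq
        (Eventually.of_forall fun ω => sq_nonneg _),
      ← ofReal_integral_eq_lintegral_ofReal hU.integrable_sq
        (Eventually.of_forall fun ω => sq_nonneg _),
      ← ENNReal.ofReal_add (integral_nonneg fun ω => sq_nonneg _)
        (integral_nonneg fun ω => sq_nonneg _)]
    congr 1
    have hcross := hind.integral_mul_eq_mul_integral hU.1 hD
    have hUD : Integrable (fun ω => 2 * (U * D) ω) ρ := (hU.integrable_mul hD2).const_mul 2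
    have h1 : (fun ω => (D - U) ω ^ 2) = fun ω => D ω ^ 2 + U ω ^ 2 - 2 * (U * D) ω := by
      ext ω
      simp only [Pi.sub_apply, Pi.mul_apply]
      ring
    have hadd : Integrable (fun ω => D ω ^ 2 + U ω ^ 2) ρ := hD2.integrable_sq.add hU.integrable_sq
    rw [h1, integral_sub hadd hUD,
      integral_add hD2.integrable_sq hU.integrable_sq, integral_const_mul, hcross, h0]
    ring
  -- With `U` square-integrable, `D` and `D - U` fail to be so together; both sides are then
  -- infinite.
  · have hDU : ¬ MemLp (D - U) 2 ρ := fun h => hD2 (by simpa using h.add hU)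
    have h1 := lintegral_sq_eq_top_of_not_memLp (hD.sub hU.1) hDU
    simp only [Pi.sub_apply] at h1
    rw [h1, lintegral_sq_eq_top_of_not_memLp hD hD2, top_add]

end Pythagoras

/-! ### The residual and the posterior mean -/

section Residual

variable {A B : DriftSpace T →L[ℝ] DriftSpace T} {t : TimeInterval T} {g : DriftSpace T}

/-- The normal equation rewrites as `A g = B (χ_t - g)`, so the sum collapses to `⟨χ_t - g, A g⟩ +
⟨g, A g⟩`. This is the residual variance. -/
theorem inner_residual_self (hg : (B + A) g = B (chi t)) :
    inner ℝ (chi t - g) (B (chi t - g)) + inner ℝ (-g) (A (-g)) = inner ℝ (chi t) (A g) := by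
  have h1 : A g = B (chi t - g) := by
    rw [map_sub, ← hg, add_apply, add_sub_cancel_left]
  rw [h1, map_neg, inner_neg_neg, h1, inner_sub_left, sub_add_cancel]

theorem inner_residual_nonneg (hA : A.IsPositive) (hB : B.IsPositive)
    (hg : (B + A) g = B (chi t)) : 0 ≤ inner ℝ (chi t) (A g) := by
  rw [← inner_residual_self hg]
  exact add_nonneg (hB.inner_nonneg_right _) (hA.inner_nonneg_right _)

theorem norm_sq_chi_le (t : TimeInterval T) : ‖chi t‖ ^ 2 ≤ (leb T).real Set.univ := by
  rw [← real_inner_self_eq_norm_sq]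
  nth_rewrite 1 [chi]
  rw [L2.inner_indicatorConstLp_one, chi]
  rw [setIntegral_congr_ae (g := fun _ => (1 : ℝ)) measurableSet_Iic]
  · simp only [setIntegral_const, smul_eq_mul, mul_one]
    exact measureReal_mono (Set.subset_univ _)
  · filter_upwards [indicatorConstLp_coeFn (p := 2) (hs := measurableSet_Iic (a := t))
      (hμs := measure_ne_top (leb T) (Set.Iic t)) (c := (1 : ℝ))] with s hs hst
    rw [hs, Set.indicator_of_mem hst]

/-- Posterior variance is at most prior variance: the difference is `⟨g, (B + A) g⟩ ≥ 0`. The bound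
is uniform in `t`, which gives integrability against a finite measure. -/
theorem inner_residual_le (hA : A.IsPositive) (hB : B.IsPositive)
    (hg : (B + A) g = B (chi t)) :
    inner ℝ (chi t) (A g) ≤ ‖B‖ * (leb T).real Set.univ := by
  have h1 : inner ℝ (chi t) (A g) = inner ℝ (chi t) (B (chi t)) - inner ℝ g ((B + A) g) := by
    have h2 : A g = B (chi t) - B g := by
      rw [← hg, add_apply, add_sub_cancel_left]
    rw [h2, inner_sub_right, hg, ← hB.inner_left_eq_inner_right (chi t) g, real_inner_comm g]
  have h3 := (hB.add hA).inner_nonneg_right g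
  have h4 : inner ℝ (chi t) (B (chi t)) ≤ ‖B‖ * ‖chi t‖ ^ 2 := by
    refine (real_inner_le_norm _ _).trans ?_
    nlinarith [B.le_opNorm (chi t), norm_nonneg (chi t)]
  have h5 := mul_le_mul_of_nonneg_left (norm_sq_chi_le t) (norm_nonneg B)
  linarith

variable {P Q : Measure (PathSpace T)} [IsProbabilityMeasure P] [IsProbabilityMeasure Q]
  {v : DriftSpace T} {JQ : DriftSpace T →L[ℝ] Lp ℝ 2 Q} {JP : DriftSpace T →L[ℝ] Lp ℝ 2 P}
  {JM : DriftSpace T →L[ℝ] Lp ℝ 2 (observationLaw P Q)}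

theorem residual_ae_eq (hJQ : IsGaussianMap Q v B JQ) (hJP : IsGaussianMap P 0 A JP)
    (hJM : IsGaussianMap (observationLaw P Q) v (B + A) JM) (t : TimeInterval T)
    (g : DriftSpace T) :
    (fun p : PathSpace T × PathSpace T => p.1 t - JM g (p.1 + p.2)) =ᵐ[Q.prod P]
      signalNoiseMap JQ JP (chi t - g, -g) := by
  have h1 : signalNoiseMap JQ JP (chi t - g, -g) =
      signalNoiseMap JQ JP (chi t, 0) - signalNoiseMap JQ JP (g, g) := by
    rw [← map_sub, Prod.mk_sub_mk, zero_sub]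
  rw [h1]
  have h0 : signalNoiseMap JQ JP (chi t, 0) =ᵐ[Q.prod P] fun p => p.1 t := by
    have h2 : JP 0 =ᵐ[P] 0 := by
      rw [map_zero]
      exact Lp.coeFn_zero _ _ _
    filter_upwards [coeFn_signalNoiseMap JQ JP (chi t) 0,
      measurePreserving_fst.quasiMeasurePreserving.ae (hJQ.apply_chi t),
      measurePreserving_snd.quasiMeasurePreserving.ae h2] with p h1 h2 h3
    rw [h1, h2, h3, Pi.zero_apply, add_zero]
  filter_upwards [Lp.coeFn_sub (signalNoiseMap JQ JP (chi t, 0)) (signalNoiseMap JQ JP (g, g)), h0,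
    comp_observation_eq_signalNoiseMap hJQ hJP hJM g] with p h1 h2 h3
  rw [h1, Pi.sub_apply, h2, ← h3]

/-- The covariance with `X_s` is `⟨χ_t - g, B χ_s⟩ - ⟨g, A χ_s⟩ = ⟨B χ_t - (B + A) g, χ_s⟩`, zero by
the normal equation. Residual and path are jointly Gaussian, so uncorrelated means independent. -/
theorem indepFun_residual (hA : A.IsPositive) (hB : B.IsPositive)
    (hJQ : IsGaussianMap Q v B JQ) (hJP : IsGaussianMap P 0 A JP)
    (hJM : IsGaussianMap (observationLaw P Q) v (B + A) JM) (hg : (B + A) g = B (chi t)) :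
    IndepFun (fun p : PathSpace T × PathSpace T => p.1 t - JM g (p.1 + p.2))
      (fun p => p.1 + p.2) (Q.prod P) := by
  have hres := residual_ae_eq hJQ hJP hJM t g
  have hproc := isGaussianProcess_of_linearMap (Ψ := (signalNoiseMap JQ JP).toLinearMap)
    (X := Sum.elim (fun (_ : Unit) (p : PathSpace T × PathSpace T) => p.1 t - JM g (p.1 + p.2))
      (fun (s : TimeInterval T) p => (p.1 + p.2) s))
    (v := Sum.elim (fun _ => (chi t - g, -g)) (fun s => (chi s, chi s)))
    (hasGaussianLaw_signalNoiseMap hJQ hJP) (by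
      rintro (_ | s)
      · exact hres
      · exact (signalNoiseMap_diag_chi hJQ hJP s).symm)
  have hind := hproc.indepFun_of_covariance_eq_zero
    (fun _ => hproc.aemeasurable (Sum.inl ())) (fun s => hproc.aemeasurable (Sum.inr s))
    (fun _ s => by
      rw [covariance_congr hres (signalNoiseMap_diag_chi hJQ hJP s).symm,
        covariance_signalNoiseMap hJQ hJP, inner_neg_left, ← hB.inner_left_eq_inner_right,
        ← hA.inner_left_eq_inner_right, ← sub_eq_add_neg, ← inner_sub_left, map_sub, sub_sub,
        ← add_apply, hg, sub_self, inner_zero_left])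
  rw [IndepFun_iff_Indep] at hind ⊢
  refine indep_of_indep_of_le_left (indep_of_indep_of_le_right hind ?_) ?_
  · rw [pathMeasurableSpace, MeasurableSpace.comap_comp]
    exact le_rfl
  · rintro _ ⟨s, hs, rfl⟩
    exact ⟨(fun x : Unit → ℝ => x ()) ⁻¹' s, measurable_pi_apply _ hs, rfl⟩

theorem integral_residual (hJQ : IsGaussianMap Q v B JQ) (hJP : IsGaussianMap P 0 A JP)
    (hJM : IsGaussianMap (observationLaw P Q) v (B + A) JM) (t : TimeInterval T)
    (g : DriftSpace T) :
    ∫ p : PathSpace T × PathSpace T, p.1 t - JM g (p.1 + p.2) ∂(Q.prod P) =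
      inner ℝ (chi t - g) v := by
  rw [integral_congr_ae (residual_ae_eq hJQ hJP hJM t g), integral_signalNoiseMap hJQ hJP]

theorem variance_residual (hJQ : IsGaussianMap Q v B JQ) (hJP : IsGaussianMap P 0 A JP)
    (hJM : IsGaussianMap (observationLaw P Q) v (B + A) JM) (hg : (B + A) g = B (chi t)) :
    Var[fun p : PathSpace T × PathSpace T => p.1 t - JM g (p.1 + p.2); Q.prod P] =
      inner ℝ (chi t) (A g) := by
  have hres := residual_ae_eq hJQ hJP hJM t g
  rw [variance_congr hres, ← covariance_self (Lp.aestronglyMeasurable _).aemeasurable,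
    covariance_signalNoiseMap hJQ hJP, inner_residual_self hg]

/-- The mean square error at time `t` of an arbitrary estimator splits into its mean square
distance to the Bayes estimator and the mean square error of the latter. -/
theorem lintegral_sq_error_eq (hA : A.IsPositive) (hB : B.IsPositive)
    (hJQ : IsGaussianMap Q v B JQ) (hJP : IsGaussianMap P 0 A JP)
    (hJM : IsGaussianMap (observationLaw P Q) v (B + A) JM) (hg : (B + A) g = B (chi t))
    {ξ η : PathSpace T → ℝ} (hξm : Measurable ξ) (hη : Measurable η)
    (hξ : ∀ᵐ ω ∂(observationLaw P Q), ξ ω = inner ℝ (chi t - g) v + JM g ω) :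
    ∫⁻ p : PathSpace T × PathSpace T, ENNReal.ofReal ((η (p.1 + p.2) - p.1 t) ^ 2) ∂(Q.prod P) =
      ∫⁻ ω, ENNReal.ofReal ((η ω - ξ ω) ^ 2) ∂(observationLaw P Q) +
        ENNReal.ofReal (inner ℝ (chi t) (A g)) := by
  set c : ℝ := inner ℝ (chi t - g) v with hc
  let U : PathSpace T × PathSpace T → ℝ := fun p => p.1 t - JM g (p.1 + p.2)
  let V : PathSpace T × PathSpace T → ℝ := fun p => p.1 t - ξ (p.1 + p.2)
  have hVU : V =ᵐ[Q.prod P] fun p => U p - c := by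
    filter_upwards [(measurePreserving_observation P Q).quasiMeasurePreserving.ae hξ] with p hp
    simp only [V, U, hp]
    ring
  have hU : MemLp U 2 (Q.prod P) :=
    (memLp_congr_ae (residual_ae_eq hJQ hJP hJM t g)).2 (Lp.memLp _)
  have hUint : ∫ p, U p ∂(Q.prod P) = c := integral_residual hJQ hJP hJM t g
  have hV : MemLp V 2 (Q.prod P) := (memLp_congr_ae hVU).2 (hU.sub (memLp_const c))
  have hV0 : ∫ p, V p ∂(Q.prod P) = 0 := by
    rw [integral_congr_ae hVU, integral_sub (hU.integrable one_le_two) (integrable_const _), hUint]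
    simp
  have hVsq : ∫⁻ p, ENNReal.ofReal (V p ^ 2) ∂(Q.prod P) =
      ENNReal.ofReal (inner ℝ (chi t) (A g)) := by
    rw [← ofReal_integral_eq_lintegral_ofReal hV.integrable_sq
      (Eventually.of_forall fun ω => sq_nonneg _), ← variance_residual hJQ hJP hJM hg,
      variance_eq_integral hU.1.aemeasurable]
    congr 1
    refine integral_congr_ae ?_
    filter_upwards [hVU] with p hp
    rw [hp, hUint]
  have hind : IndepFun V (fun p => (η - ξ) (p.1 + p.2)) (Q.prod P) :=
    ((indepFun_residual hA hB hJQ hJP hJM hg).comp (φ := fun x => x - c) (ψ := η - ξ)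
      (measurable_id.sub_const c) (hη.sub hξm)).congr hVU.symm EventuallyEq.rfl
  have hDm : Measurable fun p : PathSpace T × PathSpace T => (η - ξ) (p.1 + p.2) :=
    (hη.sub hξm).comp measurable_add_pathSpace
  have hpyth := lintegral_sq_sub_of_indepFun hind hDm.aestronglyMeasurable hV hV0
  rw [hVsq] at hpyth
  have hmap : ∫⁻ ω, ENNReal.ofReal ((η ω - ξ ω) ^ 2) ∂(observationLaw P Q) =
      ∫⁻ p : PathSpace T × PathSpace T, ENNReal.ofReal ((η - ξ) (p.1 + p.2) ^ 2) ∂(Q.prod P) := by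
    rw [observationLaw, lintegral_map (by fun_prop) measurable_add_pathSpace]
    rfl
  rw [hmap, ← hpyth]
  refine lintegral_congr fun p => ?_
  simp only [V, Pi.sub_apply]
  congr 2
  ring

/-- A jointly measurable version of the posterior mean. -/
theorem exists_isDriftEstimator_ae_eq (hA : A.IsPositive) (hB : B.IsPositive)
    (hJQ : IsGaussianMap Q v B JQ) (hJP : IsGaussianMap P 0 A JP)
    (hJM : IsGaussianMap (observationLaw P Q) v (B + A) JM) {g : TimeInterval T → DriftSpace T}
    (hg : ∀ t, (B + A) (g t) = B (chi t)) :
    ∃ ξ, IsDriftEstimator ξ ∧ ∀ t, ∀ᵐ ω ∂(observationLaw P Q),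
      ξ t ω = inner ℝ (chi t - g t) v + JM (g t) ω := by
  let W : PathSpace T × PathSpace T → PathSpace T := fun p => p.1 + p.2
  have hW : Measurable W := measurable_add_pathSpace
  -- Each `JM (g t)` is fixed only up to a null set depending on `t`. Integrating `z t` against one
  -- conditional law of the signal given the observation is measurable in `t` and the path together.
  let κ := condDistrib Prod.fst W (Q.prod P)
  have hmeas : Measurable (Function.uncurry fun (t : TimeInterval T) (ω : PathSpace T) =>
      ∫ z, z t ∂(κ ω)) := by
    have h1 : StronglyMeasurable fun q : (TimeInterval T × PathSpace T) × PathSpace T =>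
        q.2 q.1.1 :=
      (measurable_uncurry_eval.comp
        ((measurable_fst.comp measurable_fst).prodMk measurable_snd)).stronglyMeasurable
    exact (StronglyMeasurable.integral_kernel_prod_right'
      (κ := κ.comap Prod.snd measurable_snd) h1).measurable
  refine ⟨_, hmeas, fun t => ?_⟩
  set c : ℝ := inner ℝ (chi t - g t) v with hc
  let U : PathSpace T × PathSpace T → ℝ := fun p => p.1 t - JM (g t) (W p)
  have hJMm : Measurable (JM (g t)) := (Lp.stronglyMeasurable (JM (g t))).measurable
  have hUm : Measurable U :=
    ((measurable_eval t).comp measurable_fst).sub (hJMm.comp hW)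
  have hU : Integrable U (Q.prod P) :=
    ((memLp_congr_ae (residual_ae_eq hJQ hJP hJM t (g t))).2 (Lp.memLp _)).integrable one_le_two
  have hY : Integrable (fun p => JM (g t) (W p)) (Q.prod P) :=
    (measurePreserving_observation P Q).integrable_comp_of_integrable
      ((Lp.memLp (JM (g t))).integrable one_le_two)
  have hZ : Integrable (fun p : PathSpace T × PathSpace T => p.1 t) (Q.prod P) := by
    refine (hU.add hY).congr (Eventually.of_forall fun p => ?_)
    simp [U]
  have hcond := condExp_ae_eq_integral_condDistrib (μ := Q.prod P) hW
    measurable_fst.aemeasurable (measurable_eval t).stronglyMeasurable hZ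
  have hind : Indep (MeasurableSpace.comap U inferInstance)
      (MeasurableSpace.comap W inferInstance) (Q.prod P) :=
    (IndepFun_iff_Indep _ _ _).1 (indepFun_residual hA hB hJQ hJP hJM (hg t))
  -- In `z_t = U + X(g_t)`, the first term is independent of the observation and averages to `c`,
  -- while the second is a function of it.
  have hcU := condExp_indep_eq hUm.comap_le hW.comap_le
    (comap_measurable U).stronglyMeasurable hind
  have hcY : (Q.prod P)[fun p => JM (g t) (W p) | MeasurableSpace.comap W inferInstance] =
      fun p => JM (g t) (W p) :=
    condExp_of_stronglyMeasurable hW.comap_le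
      (hJMm.comp (comap_measurable W)).stronglyMeasurable hY
  have hadd := condExp_add hU hY (MeasurableSpace.comap W inferInstance)
  have hZeq : (U + fun p => JM (g t) (W p)) = fun p : PathSpace T × PathSpace T => p.1 t := by
    ext p
    simp [U]
  have hUint : ∫ p, U p ∂(Q.prod P) = c := integral_residual hJQ hJP hJM t (g t)
  rw [hZeq, hcY] at hadd
  have hfin : ∀ᵐ p ∂(Q.prod P), ∫ z, z t ∂(κ (W p)) = c + JM (g t) (W p) := by
    filter_upwards [hcond, hcU, hadd] with p h1 h2 h3
    rw [← h1, h3, Pi.add_apply, h2, hUint]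
  refine (ae_map_iff hW.aemeasurable ?_).2 hfin
  exact measurableSet_eq_fun (hmeas.comp measurable_prodMk_left) (hJMm.const_add c)

end Residual

/-! ### The Bayes risk as a time integral of mean square errors -/

theorem bayesRisk_eq_lintegral_lintegral {P Q : Measure (PathSpace T)} [SFinite P] [SFinite Q]
    (μ : Measure (TimeInterval T)) [SFinite μ] {ξ : TimeInterval T → PathSpace T → ℝ}
    (hξ : IsDriftEstimator ξ) :
    bayesRisk P Q μ ξ = ∫⁻ t, ∫⁻ p : PathSpace T × PathSpace T,
      ENNReal.ofReal ((ξ t (p.1 + p.2) - p.1 t) ^ 2) ∂(Q.prod P) ∂μ := by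
  have hjoint : Measurable fun q : (PathSpace T × PathSpace T) × TimeInterval T =>
      ENNReal.ofReal ((ξ q.2 (q.1.1 + q.1.2) - q.1.1 q.2) ^ 2) := by
    have h1 : Measurable fun q : (PathSpace T × PathSpace T) × TimeInterval T =>
        ξ q.2 (q.1.1 + q.1.2) :=
      hξ.comp (measurable_snd.prodMk (measurable_add_pathSpace.comp measurable_fst))
    have h2 : Measurable fun q : (PathSpace T × PathSpace T) × TimeInterval T => q.1.1 q.2 :=
      measurable_uncurry_eval.comp (measurable_snd.prodMk (measurable_fst.comp measurable_fst))
    exact ((h1.sub h2).pow_const 2).ennreal_ofReal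
  rw [← lintegral_lintegral_swap hjoint.aemeasurable, lintegral_prod _
    (Measurable.lintegral_prod_right' hjoint).aemeasurable, bayesRisk]
  refine lintegral_congr fun z => ?_
  rw [risk, shiftedLaw, lintegral_map]
  · have h1 : Measurable fun q : PathSpace T × TimeInterval T => ξ q.2 q.1 :=
      hξ.comp (measurable_snd.prodMk measurable_fst)
    have h2 : Measurable fun q : PathSpace T × TimeInterval T => z q.2 :=
      (z.continuous.measurable).comp measurable_snd
    exact Measurable.lintegral_prod_right' ((h1.sub h2).pow_const 2).ennreal_ofReal
  · exact measurable_add_pathSpace.comp measurable_prodMk_left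

end GaussianDrift

end

open GaussianDrift

/-! ### Assembly of the proposition -/

set_option maxHeartbeats 1000000 in
theorem proposition5p2 (T : ℝ) (hT : 0 < T)
    -- the noise: centered Gaussian law `P` with covariance operator `Γ = K K*`
    (k : TimeInterval T → TimeInterval T → ℝ) (K : DriftSpace T →L[ℝ] DriftSpace T)
    (hK : IsVolterraOperator k K)
    (P : Measure (PathSpace T)) (hP : IsGaussianPathLaw P (fun _ => 0) (kernelCov k))
    (Γ : DriftSpace T →L[ℝ] DriftSpace T) (hΓ : Γ = K ∘L ContinuousLinearMap.adjoint K)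
    -- the prior: Gaussian law `Q` with drift `v` and covariance operator `Γτ`
    (Γτ : DriftSpace T →L[ℝ] DriftSpace T) (hΓτ : Γτ.IsPositive) (v : DriftSpace T)
    (Q : Measure (PathSpace T))
    (hQ : IsGaussianPathLaw Q (toFun v) (fun s t => inner ℝ (chi s) (Γτ (chi t))))
    -- `(Γτ + Γ)⁻¹ Γτ χ_t` makes sense
    (hinj : Function.Injective (Γτ + Γ)) (hrange : ∀ t, Γτ (chi t) ∈ Set.range (Γτ + Γ))
    (μ : Measure (TimeInterval T)) [IsFiniteMeasure μ] :
    (∃ ξ, IsBayesEstimator (observationLaw P Q) Γ Γτ v ξ) ∧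
    Integrable (fun t => inner ℝ (chi t) (Γ (opInv (Γτ + Γ) (Γτ (chi t))))) μ ∧
    (∀ t : TimeInterval T, 0 ≤ inner ℝ (chi t) (Γ (opInv (Γτ + Γ) (Γτ (chi t))))) ∧
    (⨅ (ξ : TimeInterval T → PathSpace T → ℝ) (_ : IsDriftEstimator ξ), bayesRisk P Q μ ξ) =
      ENNReal.ofReal (∫ t, inner ℝ (chi t) (Γ (opInv (Γτ + Γ) (Γτ (chi t)))) ∂μ) ∧
    (∀ ξ, IsBayesEstimator (observationLaw P Q) Γ Γτ v ξ →
      -- the risk of the Bayes estimator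
      bayesRisk P Q μ ξ =
        ENNReal.ofReal (∫ t, inner ℝ (chi t) (Γ (opInv (Γτ + Γ) (Γτ (chi t)))) ∂μ) ∧
      -- it is the unique minimizer of the Bayes risk
      (∀ ξ', IsDriftEstimator ξ' → bayesRisk P Q μ ξ ≤ bayesRisk P Q μ ξ') ∧
      (∀ ξ', IsDriftEstimator ξ' → bayesRisk P Q μ ξ' ≤ bayesRisk P Q μ ξ →
        ∀ᵐ p ∂((observationLaw P Q).prod μ), ξ' p.2 p.1 = ξ p.2 p.1) ∧
      -- it is admissible
      (∀ ξ', IsDriftEstimator ξ' → (∀ z, risk P μ ξ' z ≤ risk P μ ξ z) →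
        ∀ᵐ p ∂((observationLaw P Q).prod μ), ξ' p.2 p.1 = ξ p.2 p.1)) ∧
    -- when the covariance operators commute, the constant term is `⟨χ_t, (Γτ + Γ)⁻¹ Γ v⟩`
    (Commute Γ Γτ → Γ v ∈ Set.range (Γτ + Γ) → ∀ t,
      inner ℝ (opInv (Γτ + Γ) (Γ (chi t))) v = inner ℝ (chi t) (opInv (Γτ + Γ) (Γ v))) := by
  have hprobP := hP.isProbability
  have hprobQ := hQ.isProbability
  have hΓpos : Γ.IsPositive := hΓ ▸ ContinuousLinearMap.isPositive_self_comp_adjoint K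
  have hPlaw : IsGaussianPathLaw P (toFun (0 : DriftSpace T))
      (fun s t => inner ℝ (chi s) (Γ (chi t))) := by
    have h0 : toFun (0 : DriftSpace T) = fun _ => 0 := by
      ext t
      rw [← inner_chi, inner_zero_right]
    have h1 : kernelCov k = fun s t => inner ℝ (chi s) (Γ (chi t)) := by
      ext s t
      rw [hK.kernelCov_eq, hΓ]
    rw [h0, ← h1]
    exact hP
  obtain ⟨JQ, hJQ⟩ := hQ.exists_isGaussianMap
  obtain ⟨JP, hJP⟩ := hPlaw.exists_isGaussianMap
  obtain ⟨JM, hJM⟩ := (isGaussianPathLaw_observationLaw hJQ hJP).exists_isGaussianMap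
  have hinv : ∀ x, opInv (Γτ + Γ) ((Γτ + Γ) x) = x := Function.leftInverse_invFun hinj
  set g : TimeInterval T → DriftSpace T := fun t => opInv (Γτ + Γ) (Γτ (chi t)) with hgdef
  have hg : ∀ t, (Γτ + Γ) (g t) = Γτ (chi t) := fun t => by
    obtain ⟨x, hx⟩ := hrange t
    rw [hgdef]
    simp only
    rw [← hx, hinv]
  -- Hence `Γ χ_t` also lies in the range of `Γτ + Γ`, with preimage `χ_t - g_t`.
  have hSg : ∀ t, (Γτ + Γ) (chi t - g t) = Γ (chi t) := fun t => by
    rw [map_sub, hg, add_apply, add_sub_cancel_left]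
  have hΓinv : ∀ t, opInv (Γτ + Γ) (Γ (chi t)) = chi t - g t := fun t => by rw [← hSg, hinv]
  set r : TimeInterval T → ℝ := fun t => inner ℝ (chi t) (Γ (g t)) with hr
  have hr0 : ∀ t, 0 ≤ r t := fun t => inner_residual_nonneg hΓpos hΓτ (hg t)
  have hbayes : ∀ ξ, IsBayesEstimator (observationLaw P Q) Γ Γτ v ξ ↔ IsDriftEstimator ξ ∧
      ∀ t, ∀ᵐ ω ∂(observationLaw P Q), ξ t ω = inner ℝ (chi t - g t) v + JM (g t) ω := by
    intro ξ
    refine and_congr_right fun _ => forall_congr' fun t => ?_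
    rw [hΓinv]
    constructor
    · rintro ⟨Y, hY, hξ⟩
      filter_upwards [hξ, hJM.isWienerIntegral_iff.1 hY] with ω h1 h2
      rw [h1, h2]
    · exact fun h => ⟨JM (g t), hJM.isWienerIntegral_iff.2 EventuallyEq.rfl, h⟩
  obtain ⟨ξ₀, hξ₀⟩ : ∃ ξ, IsBayesEstimator (observationLaw P Q) Γ Γτ v ξ := by
    obtain ⟨ξ, hξ⟩ := exists_isDriftEstimator_ae_eq hΓpos hΓτ hJQ hJP hJM hg
    exact ⟨ξ, (hbayes ξ).2 hξ⟩
  have herr : ∀ ξ, IsBayesEstimator (observationLaw P Q) Γ Γτ v ξ → ∀ η, IsDriftEstimator η →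
      ∀ t, ∫⁻ p : PathSpace T × PathSpace T,
        ENNReal.ofReal ((η t (p.1 + p.2) - p.1 t) ^ 2) ∂(Q.prod P) =
      ∫⁻ ω, ENNReal.ofReal ((η t ω - ξ t ω) ^ 2) ∂(observationLaw P Q) + ENNReal.ofReal (r t) :=
    fun ξ hξ η hη t => lintegral_sq_error_eq hΓpos hΓτ hJQ hJP hJM (hg t)
      (hξ.1.comp measurable_prodMk_left) (hη.comp measurable_prodMk_left)
      (((hbayes ξ).1 hξ).2 t)
  have hdist : ∀ ξ η : TimeInterval T → PathSpace T → ℝ, IsDriftEstimator ξ →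
      IsDriftEstimator η → Measurable fun q : TimeInterval T × PathSpace T =>
        ENNReal.ofReal ((η q.1 q.2 - ξ q.1 q.2) ^ 2) := fun ξ η hξ hη =>
    ((Measurable.sub hη hξ).pow_const 2).ennreal_ofReal
  -- Measurability of `r` is read off from the mean square error of `ξ₀`, which equals it and is
  -- measurable in `t` by Tonelli.
  have hrm : Measurable fun t => ENNReal.ofReal (r t) := by
    have h1 : (fun t => ENNReal.ofReal (r t)) = fun t => ∫⁻ p : PathSpace T × PathSpace T,
        ENNReal.ofReal ((ξ₀ t (p.1 + p.2) - p.1 t) ^ 2) ∂(Q.prod P) := by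
      ext t
      simp [herr ξ₀ hξ₀ ξ₀ hξ₀.1 t]
    have h2 : Measurable fun q : TimeInterval T × (PathSpace T × PathSpace T) =>
        ENNReal.ofReal ((ξ₀ q.1 (q.2.1 + q.2.2) - q.2.1 q.1) ^ 2) :=
      (((hξ₀.1.comp (measurable_fst.prodMk (measurable_add_pathSpace.comp measurable_snd))).sub
        (measurable_uncurry_eval.comp
          (measurable_fst.prodMk (measurable_fst.comp measurable_snd)))).pow_const 2).ennreal_ofReal
    rw [h1]
    exact Measurable.lintegral_prod_right' h2
  have hrm' : Measurable r := by
    have h1 : r = fun t => (ENNReal.ofReal (r t)).toReal := by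
      ext t
      rw [ENNReal.toReal_ofReal (hr0 t)]
    rw [h1]
    exact hrm.ennreal_toReal
  have hrint : Integrable r μ := by
    refine Integrable.of_bound (C := ‖Γτ‖ * (leb T).real Set.univ) hrm'.aestronglyMeasurable
      (Eventually.of_forall fun t => ?_)
    rw [Real.norm_of_nonneg (hr0 t)]
    exact inner_residual_le hΓpos hΓτ (hg t)
  have hrval : ∫⁻ t, ENNReal.ofReal (r t) ∂μ = ENNReal.ofReal (∫ t, r t ∂μ) :=
    (ofReal_integral_eq_lintegral_ofReal hrint (Eventually.of_forall hr0)).symm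
  have hrisk : ∀ ξ, IsBayesEstimator (observationLaw P Q) Γ Γτ v ξ → ∀ η, IsDriftEstimator η →
      bayesRisk P Q μ η = ∫⁻ t, ∫⁻ ω, ENNReal.ofReal ((η t ω - ξ t ω) ^ 2)
        ∂(observationLaw P Q) ∂μ + ENNReal.ofReal (∫ t, r t ∂μ) := fun ξ hξ η hη => by
    rw [bayesRisk_eq_lintegral_lintegral μ hη, lintegral_congr (herr ξ hξ η hη),
      lintegral_add_right _ hrm, hrval]
  have hopt : ∀ ξ, IsBayesEstimator (observationLaw P Q) Γ Γτ v ξ →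
      bayesRisk P Q μ ξ = ENNReal.ofReal (∫ t, r t ∂μ) := fun ξ hξ => by
    rw [hrisk ξ hξ ξ hξ.1]
    simp
  have hmin : ∀ η, IsDriftEstimator η →
      ENNReal.ofReal (∫ t, r t ∂μ) ≤ bayesRisk P Q μ η := fun η hη => by
    rw [hrisk ξ₀ hξ₀ η hη]
    exact le_add_self
  have huniq : ∀ ξ, IsBayesEstimator (observationLaw P Q) Γ Γτ v ξ → ∀ ξ', IsDriftEstimator ξ' →
      bayesRisk P Q μ ξ' ≤ bayesRisk P Q μ ξ →
      ∀ᵐ p ∂((observationLaw P Q).prod μ), ξ' p.2 p.1 = ξ p.2 p.1 := by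
    intro ξ hξ ξ' hξ' hle
    rw [hopt ξ hξ, hrisk ξ hξ ξ' hξ'] at hle
    have h0 : ∫⁻ t, ∫⁻ ω, ENNReal.ofReal ((ξ' t ω - ξ t ω) ^ 2) ∂(observationLaw P Q) ∂μ = 0 :=
      -- Cancelling the minimal risk is legitimate because it is finite.
      nonpos_iff_eq_zero.1 (ENNReal.le_of_add_le_add_right ENNReal.ofReal_ne_top (by simpa using hle))
    have hm : Measurable fun q : PathSpace T × TimeInterval T =>
        ENNReal.ofReal ((ξ' q.2 q.1 - ξ q.2 q.1) ^ 2) :=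
      (hdist ξ ξ' hξ.1 hξ').comp measurable_swap
    rw [← lintegral_lintegral_swap hm.aemeasurable, ← lintegral_prod _ hm.aemeasurable,
      lintegral_eq_zero_iff hm] at h0
    filter_upwards [h0] with p hp
    have h1 : (ξ' p.2 p.1 - ξ p.2 p.1) ^ 2 ≤ 0 := ENNReal.ofReal_eq_zero.1 hp
    exact sub_eq_zero.1 (pow_eq_zero_iff two_ne_zero |>.1 (le_antisymm h1 (sq_nonneg _)))
  refine ⟨⟨ξ₀, hξ₀⟩, hrint, hr0, ?_, fun ξ hξ => ⟨hopt ξ hξ, ?_, huniq ξ hξ, ?_⟩, ?_⟩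
  · refine le_antisymm ?_ (le_iInf₂ hmin)
    rw [← hopt ξ₀ hξ₀]
    exact iInf₂_le ξ₀ hξ₀.1
  · exact fun ξ' hξ' => hopt ξ hξ ▸ hmin ξ' hξ'
  · exact fun ξ' hξ' hle => huniq ξ hξ ξ' hξ' (lintegral_mono hle)
  · rintro hcomm ⟨b, hb⟩ t
    rw [← hb, hinv, hΓinv]
    exact inner_eq_inner_of_commute (hΓτ.add hΓpos) hinj hΓpos.isSelfAdjoint
      (hcomm.add_right (Commute.refl Γ)) (hSg t) hb
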